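/- Let $(R,\mathfrak m)$ be a regular local domain with $\dim R\ge 2$ and field of fractions $K$. Let $\operatorname{ord}_R$ be the order valuation: for $0\neq x\in R$, $\operatorname{ord}_R(x)$ is the largest $n$ with $x\in\mathfrak m^n$. We identify $\operatorname{ord}_R$ with its valuation ring in $K$. For a nonzero proper ideal $J$ of a Noetherian normal domain $A$ with field of fractions $K$, let $\operatorname{Rees}J$ be the set of Rees valuation rings of $J$, that is, the discrete valuation rings $V$ of $K$ which are local rings of the normalized blow-up $\operatorname{Proj}\overline{A[Jt]}$ at points where $J$ extends to a proper ideal. Explicitly, $V=B_P$, where $0\ne a\in J$, $B$ is the integral closure of $A[J/a]$ in $K$, and $P$ is a prime of $B$ containing $a$. A point in the first neighborhood of $R$ is a regular local ring $S$ with $\dim S\ge2$ that is a local quadratic transform of $R$, i.e. $S$ is a local ring of the blow-up $\operatorname{Proj}R[\mathfrak m t]$ that dominates $R$. For an $\mathfrak m$-primary ideal $I$ of $R$ and such $S$, the transform of $I$ in $S$ is $I^{S}=c^{-1}IS$, where $cS$ is the smallest principal ideal of $S$ containing $IS$, and $S$ is a base point of $I$ if $I^{S}\neq S$. Let $I$ be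 an $\mathfrak m$-primary ideal of $R$ that has only finitely many base points $R_1,\dots,R_n$ (possibly none) in the first neighborhood of $R$. Then $$\{\operatorname{ord}_R\}\cup\operatorname{Rees}I=\{\operatorname{ord}_R\}\cup\bigcup_{i=1}^{n}\operatorname{Rees}I^{R_i},$$ and $$\operatorname{Rees}(\mathfrak mI)=\operatorname{Rees}\mathfrak m\cup\operatorname{Rees}I=\{\operatorname{ord}_R\}\cup\operatorname{Rees}I .$$ -/

import Mathlib

/-! Notions for a domain `A` inside a field `K` (in the applications, its field of fractions).
Local rings between `A` and `K` are `LocalSubring K`, ordered by domination; valuation rings of `K`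
are `ValuationSubring K`. -/

namespace QuadTransform

/-- The ring `A[J/a]`, generated over (the image of) `A` in `K` by all quotients `b / a` with
`b ∈ J`. For `0 ≠ a ∈ J` these are the affine charts of the blow-up of `J`. -/
def blowupChart (A K : Type*) [CommRing A] [Field K] [Algebra A K] (J : Ideal A) (a : A) :
    Subring K :=
  (Algebra.adjoin A {z : K | ∃ b ∈ J, z = algebraMap A K b / algebraMap A K a}).toSubring

/-- The integral closure of `A[J/a]` in `K`. For `0 ≠ a ∈ J` these are the affine charts of the
normalized blow-up of `J`; when `A` is normal with field of fractions `K`, that is the projective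
spectrum of the integral closure of the Rees algebra `A[Jt]`. -/
def normalizedBlowupChart (A K : Type*) [CommRing A] [Field K] [Algebra A K] (J : Ideal A)
    (a : A) : Subring K :=
  (integralClosure (blowupChart A K J a) K).toSubring

/-- The Rees valuation rings of `J`: the discrete valuation rings `V` of `K` that are local rings
of the normalized blow-up of `J` at points of the exceptional locus. On the chart belonging to `a`,
the extension of `J` is generated by `a`, so the latter means that the prime contains `a`. -/
def reesValuationRings (A K : Type*) [CommRing A] [Field K] [Algebra A K] (J : Ideal A) :
    Set (ValuationSubring K) :=
  {V | IsDiscreteValuationRing V ∧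
    ∃ a ∈ J, a ≠ 0 ∧
      ∃ (P : Ideal (normalizedBlowupChart A K J a)) (_ : P.IsPrime),
        (∃ z ∈ P, (z : K) = algebraMap A K a) ∧
        V.toSubring = (LocalSubring.ofPrime (normalizedBlowupChart A K J a) P).toSubring}

/-- The order of `x` with respect to the powers of the maximal ideal:
the supremum of all `n` with `x ∈ 𝔪 ^ n`. -/
noncomputable def order (A : Type*) [CommRing A] [IsLocalRing A] (x : A) : ℕ∞ :=
  ⨆ (n : ℕ) (_ : x ∈ IsLocalRing.maximalIdeal A ^ n), (n : ℕ∞)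

/-- `V` is the valuation ring of the order function of `A`: a fraction `x / y` belongs to `V` if
and only if the order of `x` is at least the order of `y`. -/
def IsOrderValuationRing (A K : Type*) [CommRing A] [IsLocalRing A] [Field K] [Algebra A K]
    (V : ValuationSubring K) : Prop :=
  ∀ x y : A, y ≠ 0 → (algebraMap A K x / algebraMap A K y ∈ V ↔ order A y ≤ order A x)

/-- There is at most one such valuation ring of the field of fractions. -/
theorem IsOrderValuationRing.unique {A K : Type*} [CommRing A] [IsLocalRing A] [IsDomain A]
    [Field K] [Algebra A K] [IsFractionRing A K] {V W : ValuationSubring K}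
    (hV : IsOrderValuationRing A K V) (hW : IsOrderValuationRing A K W) : V = W := by
  ext z
  obtain ⟨x, y, hy, rfl⟩ := IsFractionRing.div_surjective (A := A) z
  rw [hV x y (nonZeroDivisors.ne_zero hy), hW x y (nonZeroDivisors.ne_zero hy)]

/-- The extension `I S` of an ideal `I` of `A` to an overring `S` of `A` in `K`. -/
def extension {A K : Type*} [CommRing A] [Field K] [Algebra A K] (I : Ideal A) (S : Subring K) :
    Ideal S :=
  Ideal.span {s : S | ∃ r ∈ I, (s : K) = algebraMap A K r}

/-- The transform `c⁻¹ I S` of `I` in `S`, where `c S` is the smallest principal ideal of `S` that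
contains `I S`. As `I S ⊆ c S`, the elements of `c⁻¹ I S` are the `s ∈ S` with `s c ∈ I S`; this
does not depend on the generator `c`. -/
def transform {A K : Type*} [CommRing A] [Field K] [Algebra A K] (I : Ideal A) (S : Subring K) :
    Ideal S where
  carrier := {s : S | ∀ c : S,
    IsLeast {L : Ideal S | L.IsPrincipal ∧ extension I S ≤ L} (Ideal.span {c}) →
      s * c ∈ extension I S}
  zero_mem' := fun c _ => by
    rw [zero_mul]
    exact (extension I S).zero_mem
  add_mem' := fun {s t} hs ht c hc => by
    rw [add_mul]
    exact (extension I S).add_mem (hs c hc) (ht c hc)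
  smul_mem' := fun r s hs c hc => by
    rw [smul_eq_mul, mul_assoc]
    exact (extension I S).mul_mem_left r (hs c hc)

/-- `S` is a local quadratic transform of the local domain `R`: a local ring of the blow-up of the
maximal ideal of `R` that dominates `R`. -/
def IsLocalQuadraticTransform (R K : Type*) [CommRing R] [IsLocalRing R] [Field K] [Algebra R K]
    (S : LocalSubring K) : Prop :=
  LocalSubring.range (algebraMap R K) ≤ S ∧
    ∃ x ∈ IsLocalRing.maximalIdeal R, x ≠ 0 ∧
      ∃ (P : Ideal (blowupChart R K (IsLocalRing.maximalIdeal R) x)) (_ : P.IsPrime),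
        S = LocalSubring.ofPrime (blowupChart R K (IsLocalRing.maximalIdeal R) x) P

/-- The points in the first neighborhood of `R`: the regular local rings of dimension at least two
that are local quadratic transforms of `R`. -/
def firstNeighborhood (R K : Type*) [CommRing R] [IsLocalRing R] [Field K] [Algebra R K] :
    Set (LocalSubring K) :=
  {S | IsLocalQuadraticTransform R K S ∧ IsRegularLocalRing S.toSubring ∧
    2 ≤ ringKrullDim S.toSubring}

/-- The base points of `I` in the first neighborhood of `R`: the points there in which the
transform of `I` is a proper ideal. -/
def firstBasePoints {R : Type*} (K : Type*) [CommRing R] [IsLocalRing R] [Field K] [Algebra R K]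
    (I : Ideal R) : Set (LocalSubring K) :=
  {S | S ∈ firstNeighborhood R K ∧ transform I S.toSubring ≠ ⊤}

end QuadTransform

/-! Everything is compared with Rees(𝔪I). Call a subring C of a valuation ring V saturated if it is
integrally closed in K and contains the inverses of those of its elements that are units of V. The
localization of a normalized chart at the center of V is the smallest saturated ring above that
chart. Hence V is a Rees valuation ring of J exactly when it is a discrete valuation ring above some
A[J/a], with a in its maximal ideal, and no proper saturated subring contains this chart
(`mem_reesValuationRings_iff`). The chart of 𝔪I at ya is generated by the charts of 𝔪 at y and of I
at a, so cancelling factors puts Rees 𝔪, Rees I and Rees of the transforms inside Rees(𝔪I).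

The blow-up of 𝔪 is controlled by quasi-regularity of regular parameters
(`mem_map_C_of_eval_mem_pow_succ`): for y in 𝔪 outside 𝔪², the chart D = R[𝔪/y] modulo y is a
polynomial ring over the residue field. So y is prime in D, the localization at (y) is the order
valuation ring W, and each D_Q with y ∈ Q is regular and normal because its quotient by y is. If r
is the order of I, the smallest principal ideal containing I D_Q is (y^r), so the base points are
the D_Q for which Q contains y and all b/y^r with b ∈ I.

Let V ≠ W belong to Rees(𝔪I), let y and a generate 𝔪V and IV, and let Q be the center of V on D. If
a/y^r were outside Q, then D_Q would contain the chart of I; minimality would give D_Q = V, and V ⊆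
W would force V = W. So D_Q is a base point, and minimality makes V a Rees valuation ring of the
transform there.

For V ∈ Rees I, the ring D has to lie in the local ring A of the center of V on the normalized
blow-up of I (`blowupChart_le_ofPrime_center`). By Zariski's main theorem it is enough that the
center of V is isolated in its fibre over A, on a suitable finitely generated A-algebra containing
D. A prime of this fibre inside the center contracts to a prime Q' of D containing y. If the
transform is proper at Q', then D/Q' is integral over R: its primes give base points, so its
spectrum is finite (`isIntegral_residue_of_finite_firstBasePoints`). The other Q' are excluded by
adjoining an element b, integral over A[D], with V(b) = 1 and with W(b) < 1 if A[D] ⊆ W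
(`exists_isIntegral_valuation_eq_one`). At such a Q' the ring D_Q' contains A, hence b, and b
vanishes along y = 0; this contradicts V(b) = 1. -/

open IsLocalRing

/-! ### Regular systems of parameters -/

section RegularSystem

universe u

/-- An element outside `𝔪 ^ 2` can be exchanged into a finite system of generators of `𝔪`. -/
theorem exists_generators_zero_eq {R : Type u} [CommRing R] [IsLocalRing R] {d : ℕ}
    {x : Fin (d + 1) → R} (hx : Ideal.span (Set.range x) = maximalIdeal R) {y : R}
    (hy : y ∈ maximalIdeal R) (hy2 : y ∉ maximalIdeal R ^ 2) :
    ∃ z : Fin (d + 1) → R, Ideal.span (Set.range z) = maximalIdeal R ∧ z 0 = y := by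
  have hxm : ∀ i, x i ∈ maximalIdeal R := fun i => hx ▸ Ideal.subset_span ⟨i, rfl⟩
  obtain ⟨a, ha⟩ := Submodule.mem_span_range_iff_exists_fun R |>.mp (hx ▸ hy :
    y ∈ Ideal.span (Set.range x))
  obtain ⟨j, hj⟩ : ∃ j, IsUnit (a j) := by
    by_contra! h
    refine hy2 ?_
    rw [← ha, pow_two]
    exact Ideal.sum_mem _ fun i _ => Ideal.mul_mem_mul ((mem_maximalIdeal _).mpr (h i)) (hxm i)
  refine ⟨Fin.cons y fun i => x (j.succAbove i), le_antisymm ?_ ?_, rfl⟩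
  · rw [Ideal.span_le]
    rintro _ ⟨i, rfl⟩
    refine Fin.cases ?_ (fun i => ?_) i
    · exact hy
    · exact hxm _
  · rw [← hx, Ideal.span_le]
    set J := Ideal.span (Set.range (Fin.cons y fun i => x (j.succAbove i) : Fin (d + 1) → R))
    have h0 : y ∈ J := Ideal.subset_span ⟨0, rfl⟩
    have hs : ∀ i, x (j.succAbove i) ∈ J := fun i => Ideal.subset_span ⟨i.succ, rfl⟩
    rintro _ ⟨i, rfl⟩
    rcases Fin.eq_self_or_eq_succAbove j i with rfl | ⟨k, rfl⟩
    · rw [Fin.sum_univ_succAbove _ i] at ha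
      have : a i * x i ∈ J := by
        have e : a i * x i = y - ∑ k, a (i.succAbove k) * x (i.succAbove k) := by
          rw [← ha]; simp
        rw [e]
        exact J.sub_mem h0 (J.sum_mem fun k _ => J.mul_mem_left _ (hs k))
      exact (Ideal.unit_mul_mem_iff_mem J hj).mp this
    · exact hs k

/-- The remaining generators generate the maximal ideal modulo the first one. -/
theorem span_range_quotient_generators {R : Type u} [CommRing R] [IsLocalRing R] {d : ℕ}
    {x : Fin (d + 1) → R} (hx : Ideal.span (Set.range x) = maximalIdeal R)
    [IsLocalRing (R ⧸ Ideal.span {x 0})] :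
    Ideal.span (Set.range fun i : Fin d => Ideal.Quotient.mk (Ideal.span {x 0}) (x i.succ)) =
      maximalIdeal (R ⧸ Ideal.span {x 0}) := by
  have h1 : (maximalIdeal R).map (Ideal.Quotient.mk (Ideal.span {x 0})) =
      maximalIdeal (R ⧸ Ideal.span {x 0}) :=
    le_antisymm (((local_hom_TFAE (Ideal.Quotient.mk (Ideal.span {x 0}))).out 0 2 rfl rfl).mp
      (IsLocalHom.of_surjective _ Ideal.Quotient.mk_surjective)) <| by
        intro z hz
        obtain ⟨z, rfl⟩ := Ideal.Quotient.mk_surjective z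
        refine Ideal.mem_map_of_mem _ ?_
        rw [mem_maximalIdeal] at hz ⊢
        exact fun h => hz (h.map _)
  rw [← h1, ← hx, Ideal.map_span, ← Set.range_comp]
  apply le_antisymm
  · rw [Ideal.span_le]
    rintro _ ⟨i, rfl⟩
    exact Ideal.subset_span ⟨i.succ, rfl⟩
  · rw [Ideal.span_le]
    rintro _ ⟨i, rfl⟩
    refine Fin.cases ?_ (fun i => ?_) i
    · have : Ideal.Quotient.mk (Ideal.span {x 0}) (x 0) = 0 :=
        Ideal.Quotient.eq_zero_iff_mem.mpr (Ideal.mem_span_singleton_self _)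
      simp [this]
    · exact Ideal.subset_span ⟨i, rfl⟩

theorem isLocalRing_quotient_span_generator {R : Type u} [CommRing R] [IsLocalRing R] {y : R}
    (hy : y ∈ maximalIdeal R) : IsLocalRing (R ⧸ Ideal.span {y}) := by
  have : Nontrivial (R ⧸ Ideal.span {y}) := Ideal.Quotient.nontrivial_iff.mpr fun h =>
    (maximalIdeal.isMaximal R).ne_top (top_le_iff.mp (h ▸ (Ideal.span_singleton_le_iff_mem _).mpr hy))
  exact IsLocalRing.of_surjective' _ Ideal.Quotient.mk_surjective

theorem ringKrullDim_le_of_generators {R : Type u} [CommRing R] [IsLocalRing R]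
    [IsNoetherianRing R] {d : ℕ} {x : Fin d → R}
    (hx : Ideal.span (Set.range x) = maximalIdeal R) : ringKrullDim R ≤ d := by
  refine (ringKrullDim_le_spanFinrank_maximalIdeal R).trans ?_
  rw [← hx]
  have h1 := Submodule.spanFinrank_span_le_ncard_of_finite (R := R) (Set.finite_range x)
  have h2 : (Set.range x).ncard ≤ d := by
    rw [← Set.image_univ]
    exact (Set.ncard_image_le Set.finite_univ).trans (by simp)
  exact_mod_cast h1.trans h2

/-- The d remaining generators bound the dimension from above, and one equation lowers it by at most
one. No regularity of `x 0` enters, so the result is available in the induction proving that the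
ring is a domain. -/
theorem ringKrullDim_quotient_generator {R : Type u} [CommRing R] [IsLocalRing R]
    [IsNoetherianRing R] {d : ℕ} {x : Fin (d + 1) → R}
    (hx : Ideal.span (Set.range x) = maximalIdeal R) (hd : ringKrullDim R = (d + 1 : ℕ)) :
    ringKrullDim (R ⧸ Ideal.span {x 0}) = d := by
  have hx0 : x 0 ∈ maximalIdeal R := hx ▸ Ideal.subset_span ⟨0, rfl⟩
  have := isLocalRing_quotient_span_generator hx0
  refine le_antisymm (ringKrullDim_le_of_generators (span_range_quotient_generators hx)) ?_
  have h := ringKrullDim_le_ringKrullDim_quotient_add_card (R := R) {x 0} (by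
    rw [IsLocalRing.ringJacobson_eq_maximalIdeal]; simpa using hx0)
  rw [hd] at h
  rw [Finset.coe_singleton] at h
  simp only [Finset.card_singleton, Nat.cast_add, Nat.cast_one] at h
  exact (ENat.WithBot.add_le_add_one_right_iff).mp h

/-- A Noetherian local ring of dimension `d` with `d` generators of the maximal ideal is a
domain. -/
theorem isDomain_of_generators (d : ℕ) : ∀ (R : Type u) [CommRing R] [IsLocalRing R]
    [IsNoetherianRing R] (x : Fin d → R), Ideal.span (Set.range x) = maximalIdeal R →
    ringKrullDim R = d → IsDomain R := by
  induction d with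
  | zero =>
    intro R _ _ _ x hx _
    have h : maximalIdeal R = ⊥ := by rw [← hx]; simp
    exact (isField_iff_maximalIdeal_eq.mpr h).isDomain
  | succ d ih =>
    intro R _ _ _ x hx hd
    obtain ⟨y, hym, hy⟩ : ∃ y ∈ maximalIdeal R, y ∉ maximalIdeal R ^ 2 ∧
        ∀ p ∈ minimalPrimes R, y ∉ p := by
      by_contra! h
      have hsub : ((maximalIdeal R : Ideal R) : Set R) ⊆
          ⋃ I ∈ insert (maximalIdeal R ^ 2) (minimalPrimes R), ((id I : Ideal R) : Set R) := by
        intro y hy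
        simp only [Set.mem_iUnion]
        by_cases h2 : y ∈ maximalIdeal R ^ 2
        · exact ⟨_, Set.mem_insert _ _, h2⟩
        · obtain ⟨p, hp, hyp⟩ := h y hy h2
          exact ⟨p, Set.mem_insert_of_mem _ hp, hyp⟩
      -- Prime avoidance tolerates two ideals that need not be prime; 𝔪² fills both places.
      obtain ⟨I, hI, hle⟩ := (Ideal.subset_union_prime_finite
        ((minimalPrimes.finite_of_isNoetherianRing R).insert _) (maximalIdeal R ^ 2)
        (maximalIdeal R ^ 2) (fun i hi hne _ =>
          ((Set.mem_insert_iff.mp hi).resolve_left hne).1.1)).mp hsub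
      have hht := IsLocalRing.maximalIdeal_height_eq_ringKrullDim (R := R)
      rw [hd] at hht
      rcases Set.mem_insert_iff.mp hI with rfl | hp
      · have hbot : maximalIdeal R = ⊥ :=
          Submodule.eq_bot_of_le_smul_of_le_jacobson_bot (maximalIdeal R) _
            (maximalIdeal R).fg_of_isNoetherianRing (by rwa [smul_eq_mul, ← pow_two])
            (IsLocalRing.maximalIdeal_le_jacobson _)
        have := ringKrullDim_le_of_generators (x := (Fin.elim0 : Fin 0 → R)) (by simp [hbot])
        rw [hd] at this
        exact absurd (by exact_mod_cast this) (Nat.not_succ_le_zero d)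
      · have hpp : I.IsPrime := hp.1.1
        have hm : maximalIdeal R ∈ minimalPrimes R :=
          le_antisymm hle (le_maximalIdeal hpp.ne_top) ▸ hp
        have h0 : (maximalIdeal R).height = 0 := Ideal.height_eq_zero_iff.mpr hm
        rw [h0] at hht
        exact absurd (by exact_mod_cast hht) (Nat.succ_ne_zero d).symm
    obtain ⟨z, hz, rfl⟩ := exists_generators_zero_eq hx hym hy.1
    have := isLocalRing_quotient_span_generator hym
    have hdom := ih _ _ (span_range_quotient_generators hz) (ringKrullDim_quotient_generator hz hd)
    have hprime : (Ideal.span {z 0}).IsPrime := (Ideal.Quotient.isDomain_iff_prime _).mp hdom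
    obtain ⟨p, hp, hple⟩ := Ideal.exists_minimalPrimes_le (J := Ideal.span {z 0})
      (bot_le : (⊥ : Ideal R) ≤ _)
    have hzp := hy.2 p hp
    have hpp : p.IsPrime := hp.1.1
    -- An element of p is a multiple of `z 0`, and the cofactor lies in p because `z 0` does not. So
    -- p = `z 0` p, and Nakayama's lemma applies.
    have hbot : p = ⊥ := by
      refine Submodule.eq_bot_of_le_smul_of_le_jacobson_bot (maximalIdeal R) p
        p.fg_of_isNoetherianRing ?_ (IsLocalRing.maximalIdeal_le_jacobson _)
      intro w hw
      obtain ⟨c, rfl⟩ := Ideal.mem_span_singleton.mp (hple hw)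
      exact Submodule.smul_mem_smul hym ((hpp.mem_or_mem hw).resolve_left hzp)
    have : (⊥ : Ideal R).IsPrime := hbot ▸ hpp
    exact IsDomain.of_bot_isPrime R

end RegularSystem

/-! ### Quasi-regularity of regular systems of parameters -/

section QuasiRegular

universe u

open MvPolynomial in
/-- A form in `d + 1` variables is the sum of a form in the last `d` variables and a multiple of the
first variable. -/
theorem MvPolynomial.IsHomogeneous.exists_eq_rename_add_X_mul {R : Type u} [CommRing R] {d n : ℕ}
    {F : MvPolynomial (Fin (d + 1)) R} (hF : F.IsHomogeneous (n + 1)) :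
    ∃ F₀ : MvPolynomial (Fin d) R, F₀.IsHomogeneous (n + 1) ∧
      ∃ G : MvPolynomial (Fin (d + 1)) R, G.IsHomogeneous n ∧
        F = rename Fin.succ F₀ + X 0 * G := by
  -- View F as a polynomial in `X 0` and split off its constant coefficient.
  have key : F = rename Fin.succ ((finSuccEquiv R d F).coeff 0) +
      X 0 * (finSuccEquiv R d).symm (finSuccEquiv R d F).divX := by
    apply (finSuccEquiv R d).injective
    have hC : finSuccEquiv R d (rename Fin.succ ((finSuccEquiv R d F).coeff 0)) =
        Polynomial.C ((finSuccEquiv R d F).coeff 0) := by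
      induction (finSuccEquiv R d F).coeff 0 using MvPolynomial.induction_on with
      | C a => simp [finSuccEquiv_apply]
      | add p q hp hq => simp only [map_add, hp, hq]
      | mul_X p i hp => simp only [map_mul, hp, rename_X, finSuccEquiv_X_succ]
    rw [map_add, map_mul, hC, finSuccEquiv_X_zero, AlgEquiv.apply_symm_apply]
    exact ((add_comm _ _).trans (Polynomial.X_mul_divX_add _)).symm
  refine ⟨(finSuccEquiv R d F).coeff 0, hF.finSuccEquiv_coeff_isHomogeneous 0 (n + 1) (by simp),
    _, ?_, key⟩
  set G := (finSuccEquiv R d).symm (finSuccEquiv R d F).divX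
  have hXG : (X 0 * G).IsHomogeneous (n + 1) := by
    rw [← sub_eq_iff_eq_add'.mpr key]
    exact hF.sub (hF.finSuccEquiv_coeff_isHomogeneous 0 (n + 1) (by simp)).rename_isHomogeneous
  intro α hα
  have h := @hXG (Finsupp.single 0 1 + α) (by rwa [coeff_X_mul])
  simp only [map_add] at h
  rw [Finsupp.weight_single] at h
  simp only [Pi.one_apply, smul_eq_mul, mul_one] at h
  omega

theorem MvPolynomial.IsHomogeneous.eval_mem_pow {R σ : Type*} [CommRing R] {n : ℕ}
    {F : MvPolynomial σ R} (hF : F.IsHomogeneous n) {J : Ideal R} {x : σ → R} (hx : ∀ i, x i ∈ J) :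
    MvPolynomial.eval x F ∈ J ^ n := by
  have h : MvPolynomial.eval x F ∈ Ideal.span (Set.range x) ^ n :=
    (Ideal.mem_span_pow_iff_exists_isHomogeneous x _).mpr ⟨F, hF, rfl⟩
  exact Ideal.pow_right_mono (Ideal.span_le.mpr (by rintro _ ⟨i, rfl⟩; exact hx i)) n h

theorem MvPolynomial.IsHomogeneous.eval_mem_pow_succ {R σ : Type*} [CommRing R] {n : ℕ}
    {F : MvPolynomial σ R} (hF : F.IsHomogeneous n) {J : Ideal R} {x : σ → R} (hx : ∀ i, x i ∈ J)
    (hFJ : F ∈ J.map MvPolynomial.C) : MvPolynomial.eval x F ∈ J ^ (n + 1) := by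
  rw [MvPolynomial.eval_eq, pow_succ']
  refine Ideal.sum_mem _ fun α hα => Ideal.mul_mem_mul (MvPolynomial.mem_map_C_iff.mp hFJ α) ?_
  have h := (MvPolynomial.isHomogeneous_monomial (1 : R) (d := α) (n := n) (by
    by_contra hne
    exact MvPolynomial.mem_support_iff.mp hα (hF.coeff_eq_zero hne))).eval_mem_pow hx
  rw [MvPolynomial.eval_monomial, one_mul] at h
  exact h

/-- Ideals of a Noetherian local ring are closed in the adic topology. -/
theorem Ideal.mem_of_forall_mem_sup_pow {R : Type*} [CommRing R] [IsLocalRing R]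
    [IsNoetherianRing R] {J : Ideal R} {y : R} (h : ∀ k : ℕ, y ∈ J ⊔ maximalIdeal R ^ k) :
    y ∈ J := by
  by_cases hJ : J = ⊤
  · simp [hJ]
  have : Nontrivial (R ⧸ J) := Ideal.Quotient.nontrivial_iff.mpr hJ
  have : IsLocalRing (R ⧸ J) := IsLocalRing.of_surjective' _ Ideal.Quotient.mk_surjective
  rw [← Ideal.Quotient.eq_zero_iff_mem, ← Ideal.mem_bot,
    ← Ideal.iInf_pow_eq_bot_of_isLocalRing (maximalIdeal (R ⧸ J))
      (maximalIdeal.isMaximal _).ne_top, Ideal.mem_iInf]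
  intro k
  have h1 := Ideal.mem_map_of_mem (Ideal.Quotient.mk J) (h k)
  rw [Ideal.map_sup, Ideal.map_quotient_self, bot_sup_eq, Ideal.map_pow] at h1
  exact Ideal.pow_right_mono (((local_hom_TFAE (Ideal.Quotient.mk J)).out 0 2 rfl rfl).mp
    (IsLocalHom.of_surjective _ Ideal.Quotient.mk_surjective)) k h1

open MvPolynomial in
/-- If the elements of `x` other than `x 0` are quasi-regular modulo `x 0`, then a form in them that
vanishes to higher order modulo `x 0` has its coefficients in the maximal ideal. -/
theorem mem_map_C_of_add_mem_pow_succ {R : Type u} [CommRing R] [IsLocalRing R] {d : ℕ}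
    {x : Fin (d + 1) → R} [IsLocalRing (R ⧸ Ideal.span {x 0})]
    (ih : ∀ (n : ℕ) (F : MvPolynomial (Fin d) (R ⧸ Ideal.span {x 0})), F.IsHomogeneous n →
      eval (fun i => Ideal.Quotient.mk (Ideal.span {x 0}) (x i.succ)) F ∈
        maximalIdeal (R ⧸ Ideal.span {x 0}) ^ (n + 1) →
      F ∈ (maximalIdeal (R ⧸ Ideal.span {x 0})).map C) {n : ℕ} {F : MvPolynomial (Fin d) R}
    (hF : F.IsHomogeneous n) {w : R}
    (h : eval (fun i => x i.succ) F + x 0 * w ∈ maximalIdeal R ^ (n + 1)) :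
    F ∈ (maximalIdeal R).map C := by
  have hx0 : Ideal.Quotient.mk (Ideal.span {x 0}) (x 0) = 0 :=
    Ideal.Quotient.eq_zero_iff_mem.mpr (Ideal.mem_span_singleton_self _)
  have h1 := ih n (map (Ideal.Quotient.mk (Ideal.span {x 0})) F) (hF.map _) (by
    have h2 := Ideal.mem_map_of_mem (Ideal.Quotient.mk (Ideal.span {x 0})) h
    rw [map_add, map_mul, hx0, zero_mul, add_zero, Ideal.map_pow] at h2
    have h3 := Ideal.pow_right_mono
      (((local_hom_TFAE (Ideal.Quotient.mk (Ideal.span {x 0}))).out 0 2 rfl rfl).mp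
      (IsLocalHom.of_surjective _ Ideal.Quotient.mk_surjective)) _ h2
    rwa [eval_map, ← Function.comp_def (Ideal.Quotient.mk (Ideal.span {x 0})),
      ← eval₂_comp])
  rw [mem_map_C_iff] at h1 ⊢
  intro α
  have h2 := h1 α
  rw [coeff_map, mem_maximalIdeal] at h2
  rw [mem_maximalIdeal]
  exact fun hu => h2 (hu.map _)

open MvPolynomial in
/-- Let `x` generate the maximal ideal of a local domain such that the remaining elements of `x` are
quasi-regular modulo `x 0`. Then multiplication by `x 0` raises orders by exactly one. -/
theorem mem_pow_of_mul_mem_pow_succ {R : Type u} [CommRing R] [IsLocalRing R] [IsNoetherianRing R]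
    [IsDomain R] {d : ℕ} {x : Fin (d + 1) → R}
    (hx : Ideal.span (Set.range x) = maximalIdeal R) (h0 : x 0 ≠ 0)
    [IsLocalRing (R ⧸ Ideal.span {x 0})]
    (ih : ∀ (n : ℕ) (F : MvPolynomial (Fin d) (R ⧸ Ideal.span {x 0})), F.IsHomogeneous n →
      eval (fun i => Ideal.Quotient.mk (Ideal.span {x 0}) (x i.succ)) F ∈
        maximalIdeal (R ⧸ Ideal.span {x 0}) ^ (n + 1) →
      F ∈ (maximalIdeal (R ⧸ Ideal.span {x 0})).map C) {n : ℕ} {g : R}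
    (hg : x 0 * g ∈ maximalIdeal R ^ (n + 1)) : g ∈ maximalIdeal R ^ n := by
  have hxm : ∀ i, x i ∈ maximalIdeal R := fun i => hx ▸ Ideal.subset_span ⟨i, rfl⟩
  -- Successive approximation: write `x 0 * (g - g₁)` as a form in x. Its part free of the first
  -- variable has coefficients in 𝔪 by `ih`, so its value gains one order; the rest is a multiple of
  -- `x 0` and is absorbed into g₁.
  have key : ∀ k : ℕ, ∃ g₁ ∈ maximalIdeal R ^ n,
      x 0 * (g - g₁) ∈ maximalIdeal R ^ (n + k + 1) := by
    intro k
    induction k with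
    | zero => exact ⟨0, zero_mem _, by simpa using hg⟩
    | succ k ihk =>
      obtain ⟨g₁, hg₁, h⟩ := ihk
      obtain ⟨H, hH, hHe⟩ := (Ideal.mem_span_pow_iff_exists_isHomogeneous x _).mp (hx ▸ h)
      obtain ⟨F, hF, G, hG, rfl⟩ := hH.exists_eq_rename_add_X_mul
      rw [map_add, map_mul, eval_rename, eval_X, Function.comp_def] at hHe
      have hF' := mem_map_C_of_add_mem_pow_succ ih hF (w := eval x G - (g - g₁)) (by
        rw [mul_sub, ← add_sub_assoc, sub_eq_zero.mpr hHe]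
        exact zero_mem _)
      refine ⟨g₁ + eval x G, add_mem hg₁ (Ideal.pow_le_pow_right (by omega)
        (hG.eval_mem_pow hxm)), ?_⟩
      have e : x 0 * (g - (g₁ + eval x G)) = eval (fun i => x i.succ) F := by
        linear_combination -hHe
      rw [e]
      exact hF.eval_mem_pow_succ (fun i => hxm _) hF'
  -- Krull's theorem: the ideal `x 0` 𝔪^n is closed, and the errors tend to zero.
  have h2 : x 0 * g ∈ Ideal.span {x 0} * maximalIdeal R ^ n := by
    refine Ideal.mem_of_forall_mem_sup_pow fun k => ?_
    obtain ⟨g₁, hg₁, h⟩ := key k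
    have e : x 0 * g = x 0 * g₁ + x 0 * (g - g₁) := by ring
    rw [e]
    exact Submodule.add_mem_sup (Ideal.mul_mem_mul (Ideal.mem_span_singleton_self _) hg₁)
      (Ideal.pow_le_pow_right (by omega) h)
  obtain ⟨g', hg', e⟩ := Ideal.mem_span_singleton_mul.mp h2
  exact mul_left_cancel₀ h0 e ▸ hg'

open MvPolynomial in
/-- A regular system of parameters is quasi-regular. -/
theorem mem_map_C_of_eval_mem_pow_succ (d : ℕ) : ∀ (R : Type u) [CommRing R] [IsLocalRing R]
    [IsNoetherianRing R] (x : Fin d → R), Ideal.span (Set.range x) = maximalIdeal R →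
    ringKrullDim R = d → ∀ (n : ℕ) (F : MvPolynomial (Fin d) R), F.IsHomogeneous n →
    eval x F ∈ maximalIdeal R ^ (n + 1) → F ∈ (maximalIdeal R).map C := by
  have hzero : ∀ (R : Type u) [CommRing R] [IsLocalRing R] (d : ℕ) (x : Fin d → R)
      (F : MvPolynomial (Fin d) R), F.IsHomogeneous 0 → eval x F ∈ maximalIdeal R ^ (0 + 1) →
      F ∈ (maximalIdeal R).map C := by
    intro R _ _ d x F hF h
    obtain ⟨c, rfl⟩ : ∃ c, F = C c :=
      ⟨_, (totalDegree_eq_zero_iff_eq_C.mp ((totalDegree_zero_iff_isHomogeneous _).mpr hF))⟩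
    rw [eval_C, zero_add, pow_one] at h
    exact Ideal.mem_map_of_mem _ h
  induction d with
  | zero =>
    intro R _ _ _ x hx hd n F hF h
    rcases n with _ | n
    · exact hzero R 0 x F hF h
    · rw [mem_map_C_iff]
      intro α
      rw [hF.coeff_eq_zero (by rw [Subsingleton.elim α 0]; simp)]
      exact zero_mem _
  | succ d ih =>
    intro R _ _ _ x hx hd n
    have hdom := isDomain_of_generators _ R x hx hd
    have hx0 : x 0 ∈ maximalIdeal R := hx ▸ Ideal.subset_span ⟨0, rfl⟩
    have hloc := isLocalRing_quotient_span_generator hx0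
    have hx' := span_range_quotient_generators hx
    have hdim := ringKrullDim_quotient_generator hx hd
    -- Otherwise the quotient by `x 0` would not have smaller dimension.
    have hne : x 0 ≠ 0 := by
      intro h
      have e := ringKrullDim_eq_of_ringEquiv ((Ideal.quotEquivOfEq (by rw [h]; simp :
        Ideal.span {x 0} = ⊥)).trans (RingEquiv.quotientBot R))
      rw [hd, hdim] at e
      exact absurd (by exact_mod_cast e) (Nat.succ_ne_self d).symm
    specialize ih _ _ hx' hdim
    -- The inner induction on the degree treats the part divisible by `X 0`, once the factor `x 0`
    -- is cancelled at the cost of exactly one order.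
    induction n with
    | zero => exact fun F hF h => hzero R _ x F hF h
    | succ n ihn =>
      intro F hF h
      obtain ⟨F₀, hF₀, G, hG, rfl⟩ := hF.exists_eq_rename_add_X_mul
      rw [map_add, map_mul, eval_rename, eval_X] at h
      have hF₀m := mem_map_C_of_add_mem_pow_succ ih hF₀ h
      have hF₀e := hF₀.eval_mem_pow_succ (x := fun i => x i.succ)
        (fun i => hx ▸ Ideal.subset_span ⟨i.succ, rfl⟩) hF₀m
      have hGm := ihn G hG (mem_pow_of_mul_mem_pow_succ hx hne ih
        ((Ideal.add_mem_iff_right _ hF₀e).mp h))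
      refine add_mem ?_ (Ideal.mul_mem_left _ _ hGm)
      have h1 := Ideal.mem_map_of_mem (rename (R := R) (Fin.succ (n := d))).toRingHom hF₀m
      have e : (rename (R := R) (Fin.succ (n := d))).toRingHom.comp C = C := by
        ext a : 1
        simp
      rwa [Ideal.map_map, e] at h1

/-- A regular local ring has a regular system of parameters starting with any element of
`𝔪` outside `𝔪 ^ 2`. -/
theorem IsRegularLocalRing.exists_generators {R : Type u} [CommRing R] [IsRegularLocalRing R] {y : R}
    (hy : y ∈ maximalIdeal R) (hy2 : y ∉ maximalIdeal R ^ 2) :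
    ∃ (d : ℕ) (x : Fin (d + 1) → R), Ideal.span (Set.range x) = maximalIdeal R ∧ x 0 = y ∧
      ringKrullDim R = (d + 1 : ℕ) := by
  obtain ⟨d, x, hx, hd⟩ : ∃ (d : ℕ) (x : Fin d → R),
      Ideal.span (Set.range x) = maximalIdeal R ∧ ringKrullDim R = d := by
    obtain ⟨s, hcard, hspan⟩ := Submodule.FG.exists_span_finset_card_eq_spanFinrank
      (maximalIdeal R).fg_of_isNoetherianRing
    refine ⟨s.card, fun i => (s.equivFin.symm i : R), ?_, ?_⟩
    · rw [← hspan]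
      change Submodule.span R _ = _
      congr 1
      ext z
      constructor
      · rintro ⟨i, rfl⟩
        exact (s.equivFin.symm i).2
      · exact fun hz => ⟨s.equivFin ⟨z, hz⟩, by simp⟩
    · rw [hcard]
      exact (IsRegularLocalRing.spanFinrank_maximalIdeal (R := R)).symm
  rcases d with _ | d
  · refine absurd ?_ hy2
    rw [← hx] at hy
    have : y = 0 := by simpa using hy
    exact this ▸ zero_mem _
  · obtain ⟨z, hz, hz0⟩ := exists_generators_zero_eq hx hy hy2
    exact ⟨d, z, hz, hz0, hd⟩

/-- In a regular local ring, multiplication by an element of order one raises orders by exactly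
one. -/
theorem IsRegularLocalRing.mem_pow_of_mul_mem_pow_succ {R : Type u} [CommRing R]
    [IsRegularLocalRing R] {y : R} (hy : y ∈ maximalIdeal R) (hy2 : y ∉ maximalIdeal R ^ 2) {n : ℕ}
    {g : R} (hg : y * g ∈ maximalIdeal R ^ (n + 1)) : g ∈ maximalIdeal R ^ n := by
  obtain ⟨d, x, hx, rfl, hd⟩ := IsRegularLocalRing.exists_generators hy hy2
  have := isDomain_of_generators _ R x hx hd
  have := isLocalRing_quotient_span_generator hy
  exact _root_.mem_pow_of_mul_mem_pow_succ hx (fun h => hy2 (h ▸ zero_mem _))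
    (mem_map_C_of_eval_mem_pow_succ d _ _ (span_range_quotient_generators hx)
      (ringKrullDim_quotient_generator hx hd)) hg

end QuasiRegular

namespace QuadTransform

/-! ### Affine charts of blow-ups -/

section Chart

variable {A K : Type*} [CommRing A] [Field K] [Algebra A K] {J : Ideal A} {a : A}

theorem algebraMap_mem_blowupChart (r : A) : algebraMap A K r ∈ blowupChart A K J a :=
  (Algebra.adjoin A _).algebraMap_mem r

theorem div_mem_blowupChart {b : A} (hb : b ∈ J) :
    algebraMap A K b / algebraMap A K a ∈ blowupChart A K J a :=
  Algebra.subset_adjoin ⟨b, hb, rfl⟩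

theorem blowupChart_le {C : Subring K} (h : ∀ r, algebraMap A K r ∈ C)
    (hJ : ∀ b ∈ J, algebraMap A K b / algebraMap A K a ∈ C) : blowupChart A K J a ≤ C := by
  intro z hz
  change z ∈ Algebra.adjoin A _ at hz
  induction hz using Algebra.adjoin_induction with
  | mem z hz => obtain ⟨b, hb, rfl⟩ := hz; exact hJ b hb
  | algebraMap r => exact h r
  | add _ _ _ _ h1 h2 => exact C.add_mem h1 h2
  | mul _ _ _ _ h1 h2 => exact C.mul_mem h1 h2

theorem div_pow_mem_blowupChart {n : ℕ} {b : A} (hb : b ∈ J ^ n) :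
    algebraMap A K b / algebraMap A K a ^ n ∈ blowupChart A K J a := by
  induction hb using Submodule.pow_induction_on_left' with
  | algebraMap r => simpa using algebraMap_mem_blowupChart r
  | add x y i _ _ hx hy => rw [map_add, add_div]; exact add_mem hx hy
  | mem_mul m hm i x _ hx =>
    rw [map_mul, pow_succ', mul_div_mul_comm]
    exact mul_mem (div_mem_blowupChart hm) hx

theorem exists_eq_div_pow_of_mem_blowupChart (haJ : a ∈ J) (ha : algebraMap A K a ≠ 0) {z : K}
    (hz : z ∈ blowupChart A K J a) :
    ∃ n : ℕ, ∃ b ∈ J ^ n, z = algebraMap A K b / algebraMap A K a ^ n := by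
  change z ∈ Algebra.adjoin A _ at hz
  induction hz using Algebra.adjoin_induction with
  | mem z hz => obtain ⟨b, hb, rfl⟩ := hz; exact ⟨1, b, by simpa using hb, by simp⟩
  | algebraMap r => exact ⟨0, r, by simp, by simp⟩
  | add _ _ _ _ h1 h2 =>
    obtain ⟨n, b, hb, rfl⟩ := h1
    obtain ⟨m, c, hc, rfl⟩ := h2
    refine ⟨n + m, b * a ^ m + a ^ n * c, add_mem ?_ ?_, ?_⟩
    · rw [pow_add]; exact Ideal.mul_mem_mul hb (Ideal.pow_mem_pow haJ m)
    · rw [pow_add]; exact Ideal.mul_mem_mul (Ideal.pow_mem_pow haJ n) hc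
    · simp only [map_add, map_mul, map_pow]
      field_simp
      ring
  | mul _ _ _ _ h1 h2 =>
    obtain ⟨n, b, hb, rfl⟩ := h1
    obtain ⟨m, c, hc, rfl⟩ := h2
    refine ⟨n + m, b * c, ?_, ?_⟩
    · rw [pow_add]; exact Ideal.mul_mem_mul hb hc
    · rw [map_mul, pow_add, mul_div_mul_comm]

variable (A K J a) in
/-- The structure map of an affine chart. -/
def chartHom : A →+* blowupChart A K J a :=
  (algebraMap A K).codRestrict _ algebraMap_mem_blowupChart

@[simp]
theorem coe_chartHom (r : A) : (chartHom A K J a r : K) = algebraMap A K r := rfl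

end Chart

/-! ### Charts of the blow-up of the maximal ideal of a regular local ring. -/

section RegularChart

universe u v

variable {R : Type u} {K : Type v} [CommRing R] [Field K] [Algebra R K]

/-- An element of `R` that is divisible by `y ^ n` in the chart of the blow-up of `𝔪` belonging to
`y` lies in `𝔪 ^ n`. -/
theorem mem_pow_of_eq_pow_mul [FaithfulSMul R K] [IsRegularLocalRing R] {y : R} (hy : y ∈ maximalIdeal R)
    (hy2 : y ∉ maximalIdeal R ^ 2) {n : ℕ} {g : R} {z : K}
    (hz : z ∈ blowupChart R K (maximalIdeal R) y)
    (h : algebraMap R K g = algebraMap R K y ^ n * z) : g ∈ maximalIdeal R ^ n := by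
  have hinj := FaithfulSMul.algebraMap_injective R K
  have hy0 : algebraMap R K y ≠ 0 := fun h0 =>
    hy2 ((hinj (h0.trans (map_zero _).symm)) ▸ zero_mem _)
  obtain ⟨j, w, hw, rfl⟩ := exists_eq_div_pow_of_mem_blowupChart hy hy0 hz
  have e : y ^ j * g = y ^ n * w := by
    apply hinj
    simp only [map_mul, map_pow, h]
    field_simp
  have h1 : y ^ j * g ∈ maximalIdeal R ^ (n + j) := by
    rw [e, pow_add]
    exact Ideal.mul_mem_mul (Ideal.pow_mem_pow hy n) hw
  clear e h hz hw
  -- Cancel the j factors y one at a time, each lowering the order by one.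
  induction j with
  | zero => simpa using h1
  | succ j ih =>
    refine ih (IsRegularLocalRing.mem_pow_of_mul_mem_pow_succ hy hy2 ?_)
    rwa [← mul_assoc, ← pow_succ', add_assoc]

open MvPolynomial in
/-- The presentation of the chart of the blow-up of the maximal ideal belonging to the first of
given generators. -/
noncomputable def chartPresentation [IsLocalRing R] {d : ℕ} (x : Fin (d + 1) → R)
    (hx : Ideal.span (Set.range x) = maximalIdeal R) :
    MvPolynomial (Fin d) R →+* blowupChart R K (maximalIdeal R) (x 0) :=
  eval₂Hom (chartHom R K (maximalIdeal R) (x 0)) fun i =>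
    ⟨algebraMap R K (x i.succ) / algebraMap R K (x 0),
      div_mem_blowupChart (hx ▸ Ideal.subset_span ⟨i.succ, rfl⟩)⟩

open MvPolynomial in
theorem coe_chartPresentation [IsLocalRing R] {d : ℕ} (x : Fin (d + 1) → R)
    (hx : Ideal.span (Set.range x) = maximalIdeal R) (f : MvPolynomial (Fin d) R) :
    (chartPresentation (K := K) x hx f : K) =
      eval₂ (algebraMap R K) (fun i => algebraMap R K (x i.succ) / algebraMap R K (x 0)) f := by
  have := eval₂_comp_left (blowupChart R K (maximalIdeal R) (x 0)).subtype
    (chartHom R K (maximalIdeal R) (x 0)) (fun i =>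
    ⟨algebraMap R K (x i.succ) / algebraMap R K (x 0),
      div_mem_blowupChart (hx ▸ Ideal.subset_span ⟨i.succ, rfl⟩)⟩) f
  exact this

open MvPolynomial in
theorem chartPresentation_surjective [IsLocalRing R] {d : ℕ} (x : Fin (d + 1) → R)
    (hx : Ideal.span (Set.range x) = maximalIdeal R) (hx0 : algebraMap R K (x 0) ≠ 0) :
    Function.Surjective (chartPresentation (K := K) x hx) := by
  have hle : blowupChart R K (maximalIdeal R) (x 0) ≤
      ((blowupChart R K (maximalIdeal R) (x 0)).subtype.comp (chartPresentation x hx)).range := by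
    have hC : ∀ r, algebraMap R K r ∈ ((blowupChart R K (maximalIdeal R) (x 0)).subtype.comp
        (chartPresentation x hx)).range := fun r =>
      ⟨C r, by simp [coe_chartPresentation]⟩
    refine blowupChart_le hC fun b hb => ?_
    obtain ⟨c, rfl⟩ := Submodule.mem_span_range_iff_exists_fun R |>.mp (hx ▸ hb :
      b ∈ Ideal.span (Set.range x))
    rw [map_sum, Finset.sum_div]
    refine sum_mem fun i _ => ?_
    rw [smul_eq_mul, map_mul, mul_div_assoc]
    refine mul_mem (hC _) ?_
    refine Fin.cases ?_ (fun i => ?_) i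
    · rw [div_self hx0]; exact one_mem _
    · exact ⟨X i, by simp [coe_chartPresentation]⟩
  intro z
  obtain ⟨f, hf⟩ := hle z.2
  exact ⟨f, Subtype.ext hf⟩

open MvPolynomial in
/-- The homogenization of degree `N` with respect to a new first variable. -/
theorem exists_homogenization {d : ℕ} (f : MvPolynomial (Fin d) R) {N : ℕ} (hN : f.totalDegree ≤ N) :
    ∃ F : MvPolynomial (Fin (d + 1)) R, F.IsHomogeneous N ∧
      (∀ J : Ideal R, F ∈ J.map C → f ∈ J.map C) ∧
      ∀ x : Fin (d + 1) → R, algebraMap R K (x 0) ≠ 0 →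
        algebraMap R K (eval x F) = algebraMap R K (x 0) ^ N * eval₂ (algebraMap R K)
          (fun i => algebraMap R K (x i.succ) / algebraMap R K (x 0)) f := by
  refine ⟨∑ α ∈ f.support, monomial (Finsupp.cons (N - α.degree) α) (coeff α f), ?_, ?_, ?_⟩
  · refine IsHomogeneous.sum _ _ _ fun α hα => isHomogeneous_monomial _ ?_
    have := (le_totalDegree hα).trans hN
    simp only [Finsupp.degree_eq_sum, Fin.sum_univ_succ, Finsupp.cons_zero, Finsupp.cons_succ]
    rw [Finsupp.sum_fintype _ _ (fun _ => rfl)] at this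
    omega
  · intro J hF
    rw [mem_map_C_iff] at hF ⊢
    intro α
    by_cases hα : α ∈ f.support
    · have h := hF (Finsupp.cons (N - α.degree) α)
      rw [coeff_sum, Finset.sum_eq_single α] at h
      · simpa using h
      · intro β _ hβ
        rw [coeff_monomial, if_neg]
        intro e
        exact hβ (by simpa using congrArg Finsupp.tail e)
      · exact fun h => absurd hα h
    · rw [notMem_support_iff.mp hα]; exact zero_mem _
  · intro x hx
    rw [eval₂_eq', map_sum, map_sum, Finset.mul_sum]
    refine Finset.sum_congr rfl fun α hα => ?_
    have hle := (le_totalDegree hα).trans hN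
    rw [Finsupp.sum_fintype _ _ (fun _ => rfl)] at hle
    rw [eval_monomial, Finsupp.prod_fintype _ _ (fun _ => pow_zero _), Fin.prod_univ_succ]
    simp only [Finsupp.cons_zero, Finsupp.cons_succ, map_mul, map_pow, map_prod, div_pow,
      Finset.prod_div_distrib, Finset.prod_pow_eq_pow_sum, Finsupp.degree_eq_sum]
    obtain ⟨k, hk⟩ := Nat.exists_eq_add_of_le hle
    rw [hk, Nat.add_sub_cancel_left, pow_add]
    field_simp

open MvPolynomial in
-- This is quasi-regularity after dehomogenizing. If the image of f is `x 0` times b/(`x 0`)^n with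
-- b ∈ 𝔪^n, the homogenization of f of degree N = deg f + n takes a value in 𝔪^(N+1), so its
-- coefficients are in 𝔪. Conversely, 𝔪 becomes divisible by `x 0` in the chart.
theorem chartPresentation_mem_span_iff [FaithfulSMul R K] [IsLocalRing R] [IsNoetherianRing R] {d : ℕ}
    (x : Fin (d + 1) → R) (hx : Ideal.span (Set.range x) = maximalIdeal R)
    (hd : ringKrullDim R = (d + 1 : ℕ)) (hx0 : algebraMap R K (x 0) ≠ 0)
    (f : MvPolynomial (Fin d) R) :
    chartPresentation (K := K) x hx f ∈
      Ideal.span {chartHom R K (maximalIdeal R) (x 0) (x 0)} ↔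
      f ∈ (maximalIdeal R).map C := by
  have hx0m : x 0 ∈ maximalIdeal R := hx ▸ Ideal.subset_span ⟨0, rfl⟩
  constructor
  · intro h
    obtain ⟨w, hw⟩ := Ideal.mem_span_singleton.mp h
    obtain ⟨n, b, hb, hwb⟩ := exists_eq_div_pow_of_mem_blowupChart hx0m hx0 w.2
    obtain ⟨F, hF, hFJ, hFe⟩ := exists_homogenization (K := K) f
      (N := f.totalDegree + n) (by omega)
    refine hFJ _ (mem_map_C_of_eval_mem_pow_succ _ R x hx hd _ F hF ?_)
    have e : eval x F = x 0 ^ (f.totalDegree + 1) * b := by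
      apply FaithfulSMul.algebraMap_injective R K
      rw [hFe x hx0, ← coe_chartPresentation x hx, hw]
      simp only [Subring.coe_mul, coe_chartHom, hwb, map_mul, map_pow]
      field_simp
      ring
    rw [e, show f.totalDegree + n + 1 = f.totalDegree + 1 + n by ring, pow_add _ (_ + 1) n]
    exact Ideal.mul_mem_mul (Ideal.pow_mem_pow hx0m _) hb
  · intro h
    have h1 := Ideal.mem_map_of_mem (chartPresentation (K := K) x hx) h
    rw [Ideal.map_map] at h1
    refine (Ideal.map_le_iff_le_comap.mpr fun b hb => ?_) h1
    rw [Ideal.mem_comap, Ideal.mem_span_singleton]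
    exact ⟨⟨_, div_mem_blowupChart hb⟩, Subtype.ext (by
      simp [coe_chartPresentation, mul_div_cancel₀ _ hx0])⟩

open MvPolynomial in
/-- The exceptional fibre of the chart is an affine space over the residue field. -/
theorem exists_quotient_equiv_mvPolynomial [FaithfulSMul R K] [IsRegularLocalRing R] {y : R}
    (hy : y ∈ maximalIdeal R) (hy2 : y ∉ maximalIdeal R ^ 2) :
    ∃ d : ℕ, Nonempty (blowupChart R K (maximalIdeal R) y ⧸
      Ideal.span {chartHom R K (maximalIdeal R) y y} ≃+*
        MvPolynomial (Fin d) (ResidueField R)) := by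
  have hinj := FaithfulSMul.algebraMap_injective R K
  have hy0 : algebraMap R K y ≠ 0 := fun h0 =>
    hy2 ((hinj (h0.trans (map_zero _).symm)) ▸ zero_mem _)
  obtain ⟨d, x, hx, rfl, hd⟩ := IsRegularLocalRing.exists_generators hy hy2
  let ψ := (Ideal.Quotient.mk (Ideal.span {chartHom R K (maximalIdeal R) (x 0) (x 0)})).comp
    (chartPresentation (K := K) x hx)
  have hψ : Function.Surjective ψ :=
    Ideal.Quotient.mk_surjective.comp (chartPresentation_surjective x hx hy0)
  have hker : RingHom.ker ψ = RingHom.ker (map (σ := Fin d) (residue R)) := by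
    ext f
    rw [ker_map, ker_residue, ← chartPresentation_mem_span_iff (K := K) x hx hd hy0,
      RingHom.mem_ker, RingHom.comp_apply, Ideal.Quotient.eq_zero_iff_mem]
  exact ⟨d, ⟨(RingHom.quotientKerEquivOfSurjective hψ).symm.trans
    ((Ideal.quotEquivOfEq hker).trans (RingHom.quotientKerEquivOfSurjective
      (map_surjective _ residue_surjective)))⟩⟩

theorem isNoetherianRing_blowupChart [FaithfulSMul R K] [IsRegularLocalRing R] {y : R}
    (hy : y ∈ maximalIdeal R) (hy2 : y ∉ maximalIdeal R ^ 2) :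
    IsNoetherianRing (blowupChart R K (maximalIdeal R) y) := by
  have hinj := FaithfulSMul.algebraMap_injective R K
  have hy0 : algebraMap R K y ≠ 0 := fun h0 =>
    hy2 ((hinj (h0.trans (map_zero _).symm)) ▸ zero_mem _)
  obtain ⟨d, x, hx, rfl, hd⟩ := IsRegularLocalRing.exists_generators hy hy2
  exact isNoetherianRing_of_surjective _ _ _ (chartPresentation_surjective (K := K) x hx hy0)

end RegularChart

end QuadTransform

/-! ### Lifting normality and regularity from a hypersurface -/

section Lifting

/-- The hypothesis makes y/z almost integral with common denominator c, and over a Noetherian ring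
almost integral elements are integral. -/
theorem dvd_of_forall_pow_dvd_mul_pow {S : Type*} [CommRing S] [IsDomain S] [IsNoetherianRing S]
    [IsIntegrallyClosed S] {c y z : S} (hc : c ≠ 0) (hz : z ≠ 0) (h : ∀ n, z ^ n ∣ c * y ^ n) :
    z ∣ y := by
  let F := FractionRing S
  have hz' : algebraMap S F z ≠ 0 := by simpa using hz
  have h1 : IsAlmostIntegral S (algebraMap S F y / algebraMap S F z) := by
    refine ⟨c, mem_nonZeroDivisors_of_ne_zero hc, fun n => ?_⟩
    obtain ⟨w, hw⟩ := h n
    refine ⟨w, ?_⟩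
    rw [Algebra.smul_def, div_pow, ← mul_div_assoc, eq_div_iff (pow_ne_zero _ hz'), ← map_pow,
      ← map_pow, ← map_mul, ← map_mul, hw, mul_comm]
  obtain ⟨w, hw⟩ := IsIntegrallyClosed.isIntegral_iff.mp h1.isIntegral
  refine ⟨w, FaithfulSMul.algebraMap_injective S F ?_⟩
  rw [map_mul, hw, mul_div_cancel₀ _ hz']

/-- Integral fractions are almost integral. Normality thus becomes a divisibility statement, which
can be lifted from a quotient. -/
theorem isIntegrallyClosed_of_forall_dvd {S : Type*} [CommRing S] [IsDomain S]
    (h : ∀ c y z : S, c ≠ 0 → z ≠ 0 → (∀ n, z ^ n ∣ c * y ^ n) → z ∣ y) :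
    IsIntegrallyClosed S := by
  rw [isIntegrallyClosed_iff (FractionRing S)]
  intro w hw
  obtain ⟨y, z, hz, rfl⟩ := IsFractionRing.div_surjective (A := S) w
  have hz0 := nonZeroDivisors.ne_zero hz
  have hz' : algebraMap S (FractionRing S) z ≠ 0 := by simpa using hz0
  obtain ⟨c, hc, hcn⟩ := hw.isAlmostIntegral
  obtain ⟨b, rfl⟩ := h c y z (nonZeroDivisors.ne_zero hc) hz0 fun n => by
    obtain ⟨w, hw⟩ := hcn n
    refine ⟨w, FaithfulSMul.algebraMap_injective S (FractionRing S) ?_⟩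
    rw [Algebra.smul_def, div_pow, ← mul_div_assoc, eq_div_iff (pow_ne_zero _ hz')] at hw
    simp only [map_mul, map_pow]
    rw [← hw, mul_comm]
  exact ⟨b, by rw [map_mul, mul_div_cancel_left₀ _ hz']⟩

theorem Prime.pow_dvd_of_pow_dvd_pow_mul {S : Type*} [CommRing S] [IsDomain S] {x z : S}
    (hx : Prime x) (hxz : ¬ x ∣ z) {n k : ℕ} {t : S} (h : z ^ n ∣ x ^ k * t) : z ^ n ∣ t := by
  obtain ⟨w, hw⟩ := h
  obtain ⟨w', rfl⟩ := hx.pow_dvd_of_dvd_mul_left k (fun h => hxz (hx.dvd_of_dvd_pow h))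
    (Dvd.intro _ hw)
  exact ⟨w', mul_left_cancel₀ (pow_ne_zero k hx.ne_zero) (by rw [hw]; ring)⟩

/-- A Noetherian local domain is integrally closed if its quotient by some prime element is. -/
theorem isIntegrallyClosed_of_quotient_prime {S : Type*} [CommRing S] [IsDomain S] [IsLocalRing S]
    [IsNoetherianRing S] {x : S} (hx : Prime x) [IsDomain (S ⧸ Ideal.span {x})]
    [IsIntegrallyClosed (S ⧸ Ideal.span {x})] : IsIntegrallyClosed S := by
  have hmk : ∀ s : S, Ideal.Quotient.mk (Ideal.span {x}) s = 0 ↔ x ∣ s := fun s =>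
    Ideal.Quotient.eq_zero_iff_mem.trans Ideal.mem_span_singleton
  have hfin : ∀ {z : S}, z ≠ 0 → ∃ k z', ¬ x ∣ z' ∧ z = x ^ k * z' := fun hz =>
    have ⟨c, h1, h2⟩ := (FiniteMultiplicity.of_not_isUnit hx.not_isUnit
      hz).exists_eq_pow_mul_and_not_dvd
    ⟨_, c, h2, h1⟩
  -- When x divides neither c nor z, normality of S/x gives y = z b + x y'. The remainder y'
  -- satisfies the same divisibilities, so iteration puts y in every (z) + (x^k), hence in (z).
  have main : ∀ c y z : S, ¬ x ∣ c → ¬ x ∣ z → (∀ n, z ^ n ∣ c * y ^ n) → z ∣ y := by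
    intro c y z hc hz h
    have step : ∀ y, (∀ n, z ^ n ∣ c * y ^ n) → ∃ b y', y = z * b + x * y' ∧
        ∀ n, z ^ n ∣ c * y' ^ n := by
      intro y h
      obtain ⟨b, hb⟩ := dvd_of_forall_pow_dvd_mul_pow
        (mt (hmk c).mp hc) (mt (hmk z).mp hz) (y := Ideal.Quotient.mk (Ideal.span {x}) y)
        fun n => by
          rw [← map_pow, ← map_pow, ← map_mul]
          exact map_dvd _ (h n)
      obtain ⟨b, rfl⟩ := Ideal.Quotient.mk_surjective b
      rw [← map_mul, Ideal.Quotient.eq, Ideal.mem_span_singleton] at hb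
      obtain ⟨y', hy'⟩ := hb
      refine ⟨b, y', by rw [← hy']; ring, fun n => ?_⟩
      refine hx.pow_dvd_of_pow_dvd_pow_mul hz (k := n) ?_
      -- In the binomial expansion each term contains c y^i z^(n-i), which is divisible by z^i
      -- z^(n-i).
      have e : x ^ n * (c * y' ^ n) = c * (y + -(z * b)) ^ n := by
        rw [← sub_eq_add_neg, hy']; ring
      rw [e, add_pow, Finset.mul_sum]
      refine Finset.dvd_sum fun i hi => ?_
      have hi' : n = i + (n - i) := by have := Finset.mem_range.mp hi; omega
      have e2 : c * (y ^ i * (-(z * b)) ^ (n - i) * (n.choose i : S)) =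
          (c * y ^ i) * z ^ (n - i) * ((-b) ^ (n - i) * (n.choose i : S)) := by ring
      rw [e2]
      refine Dvd.dvd.mul_right ?_ _
      conv_lhs => rw [hi', pow_add]
      exact mul_dvd_mul (h i) dvd_rfl
    have iter : ∀ k : ℕ, ∃ b y', y = z * b + x ^ k * y' ∧ ∀ n, z ^ n ∣ c * y' ^ n := by
      intro k
      induction k with
      | zero => exact ⟨0, y, by simp, h⟩
      | succ k ih =>
        obtain ⟨b, y', rfl, h'⟩ := ih
        obtain ⟨b', y'', rfl, h''⟩ := step y' h'
        exact ⟨b + x ^ k * b', y'', by ring, h''⟩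
    rw [← Ideal.mem_span_singleton]
    refine Ideal.mem_of_forall_mem_sup_pow fun k => ?_
    obtain ⟨b, y', e, -⟩ := iter k
    rw [e]
    exact Submodule.add_mem_sup (Ideal.mul_mem_right _ _ (Ideal.mem_span_singleton_self z))
      (Ideal.mul_mem_right _ _ (Ideal.pow_mem_pow ((mem_maximalIdeal x).mpr hx.not_isUnit) k))
  refine isIntegrallyClosed_of_forall_dvd fun c y z hc hz h => ?_
  obtain ⟨k, c, hxc, rfl⟩ := hfin hc
  obtain ⟨m, z, hxz, rfl⟩ := hfin hz
  have hxy : x ^ m ∣ y := by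
    clear hz
    induction m generalizing y with
    | zero => simp
    | succ m ih =>
      have h1 : x ∣ y := by
        -- The exponent k + 1 is just large enough to beat the factor x^k of the denominator.
        have h2 : x ^ (k + 1) ∣ x ^ k * (c * y ^ (k + 1)) := by
          rw [← mul_assoc]
          refine dvd_trans ?_ (h (k + 1))
          rw [mul_pow, ← pow_mul]
          exact Dvd.dvd.mul_right (pow_dvd_pow _ (by nlinarith)) _
        rw [pow_succ] at h2
        have h3 := (mul_dvd_mul_iff_left (pow_ne_zero k hx.ne_zero)).mp h2
        exact hx.dvd_of_dvd_pow ((hx.dvd_or_dvd h3).resolve_left hxc)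
      obtain ⟨y, rfl⟩ := h1
      rw [pow_succ']
      refine mul_dvd_mul_left x (ih y fun n => ?_)
      have h2 := h n
      have e1 : (x ^ (m + 1) * z) ^ n = x ^ n * (x ^ m * z) ^ n := by ring
      have e2 : x ^ k * c * (x * y) ^ n = x ^ n * (x ^ k * c * y ^ n) := by ring
      rw [e1, e2] at h2
      exact (mul_dvd_mul_iff_left (pow_ne_zero n hx.ne_zero)).mp h2
  obtain ⟨y, rfl⟩ := hxy
  refine mul_dvd_mul_left _ (main c y z hxc hxz fun n => ?_)
  have h2 := h n
  have e1 : (x ^ m * z) ^ n = x ^ (m * n) * z ^ n := by ring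
  have e2 : x ^ k * c * (x ^ m * y) ^ n = x ^ (m * n) * (x ^ k * (c * y ^ n)) := by ring
  rw [e1, e2] at h2
  exact hx.pow_dvd_of_pow_dvd_pow_mul hxz
    ((mul_dvd_mul_iff_left (pow_ne_zero _ hx.ne_zero)).mp h2)

/-- A Noetherian local ring is regular if its quotient by some nonzerodivisor is. -/
theorem isRegularLocalRing_of_quotient {S : Type*} [CommRing S] [IsLocalRing S]
    [IsNoetherianRing S] {x : S} (hx : x ∈ nonZeroDivisors S) (hxm : x ∈ maximalIdeal S)
    [IsRegularLocalRing (S ⧸ Ideal.span {x})] : IsRegularLocalRing S := by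
  refine IsRegularLocalRing.of_spanFinrank_maximalIdeal_le _ ?_
  rw [← ringKrullDim_quotient_span_singleton_succ_eq_ringKrullDim_of_mem_nonZeroDivisors hx hxm,
    ← IsRegularLocalRing.spanFinrank_maximalIdeal (R := S ⧸ Ideal.span {x})]
  obtain ⟨s, hcard, hspan⟩ := Submodule.FG.exists_span_finset_card_eq_spanFinrank
      (maximalIdeal (S ⧸ Ideal.span {x})).fg_of_isNoetherianRing
  rw [← hcard]
  classical
  obtain ⟨g, hg⟩ := (Ideal.Quotient.mk_surjective (I := Ideal.span {x})).hasRightInverse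
  -- The added generator x is matched by the dimension, which also grows by one from S/x to S.
  have hle : maximalIdeal S ≤ Ideal.span ((insert x (s.image g) : Finset S) : Set S) := by
    intro y hy
    have h1 : Ideal.Quotient.mk (Ideal.span {x}) y ∈
        (Ideal.span ((s.image g : Finset S) : Set S)).map (Ideal.Quotient.mk (Ideal.span {x})) := by
      rw [Ideal.map_span, Finset.coe_image, ← Set.image_comp, hg.id, Set.image_id]
      change _ ∈ Submodule.span _ _
      rw [hspan]
      exact ((local_hom_TFAE (Ideal.Quotient.mk (Ideal.span {x}))).out 0 2 rfl rfl).mp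
        (IsLocalHom.of_surjective _ Ideal.Quotient.mk_surjective) (Ideal.mem_map_of_mem _ hy)
    rw [← Ideal.mem_comap, Ideal.comap_map_of_surjective _ Ideal.Quotient.mk_surjective,
      ← RingHom.ker_eq_comap_bot, Ideal.mk_ker, sup_comm, ← Ideal.span_union] at h1
    rwa [Finset.coe_insert, Set.insert_eq]
  have hge : Ideal.span ((insert x (s.image g) : Finset S) : Set S) ≤ maximalIdeal S := by
    rw [Ideal.span_le]
    intro y hy
    rcases Finset.mem_insert.mp hy with rfl | hy
    · exact hxm
    · obtain ⟨z, hz, rfl⟩ := Finset.mem_image.mp hy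
      have hz' : z ∈ maximalIdeal (S ⧸ Ideal.span {x}) := hspan ▸ Submodule.subset_span hz
      rw [SetLike.mem_coe, mem_maximalIdeal]
      rw [mem_maximalIdeal] at hz'
      exact fun h => hz' (hg z ▸ h.map (Ideal.Quotient.mk (Ideal.span {x})))
  rw [le_antisymm hle hge]
  have h1 := Submodule.spanFinrank_span_le_ncard_of_finite (R := S)
    (insert x (s.image g)).finite_toSet
  rw [Set.ncard_coe_finset] at h1
  exact_mod_cast h1.trans ((Finset.card_insert_le _ _).trans
    (Nat.succ_le_succ Finset.card_image_le))

end Lifting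

/-! ### Localizations of subrings of a field, and quotients of localizations. -/

theorem LocalSubring.mem_ofPrime_iff {K : Type*} [Field K] {A : Subring K} {P : Ideal A}
    [P.IsPrime] {z : K} :
    z ∈ (LocalSubring.ofPrime A P).toSubring ↔ ∃ s t : A, t ∉ P ∧ z = s / t := by
  constructor
  · intro hz
    obtain ⟨s, t, h⟩ := IsLocalization.exists_mk'_eq P.primeCompl
      (⟨z, hz⟩ : (LocalSubring.ofPrime A P).toSubring)
    rw [IsLocalization.mk'_eq_iff_eq_mul] at h
    have ht : (t : A) ∉ P := t.2
    refine ⟨s, t, ht, ?_⟩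
    have ht0 : ((t : A) : K) ≠ 0 := fun h0 => ht (by
      rw [show (t : A) = 0 from Subtype.ext h0]; exact zero_mem _)
    rw [eq_div_iff ht0]
    exact (congrArg Subtype.val h).symm
  · rintro ⟨s, t, ht, rfl⟩
    have ht0 : (t : K) ≠ 0 := fun h0 => ht (by
      rw [show t = 0 from Subtype.ext h0]; exact zero_mem _)
    obtain ⟨u, hu⟩ := IsLocalization.map_units (LocalSubring.ofPrime A P).toSubring
      (⟨t, ht⟩ : P.primeCompl)
    have h1 : ((u⁻¹ : (LocalSubring.ofPrime A P).toSubringˣ) :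
        (LocalSubring.ofPrime A P).toSubring).1 = (t : K)⁻¹ := by
      refine eq_inv_of_mul_eq_one_left ?_
      have := congrArg Subtype.val u.inv_mul
      rw [hu] at this
      exact this
    rw [div_eq_mul_inv, ← h1]
    exact mul_mem (LocalSubring.le_ofPrime A P s.2) (Subtype.property _)

/-- The localization at `Q` of a quotient by an ideal inside `Q`. -/
theorem IsLocalization.AtPrime.exists_quotient_equiv {D S T : Type*} [CommRing D] [CommRing S]
    [CommRing T] [Algebra D S] (Q : Ideal D) [Q.IsPrime] [IsLocalization.AtPrime S Q] {L : Ideal D}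
    (hL : L ≤ Q) (e : D ⧸ L ≃+* T) :
    ∃ (Q' : Ideal T) (_ : Q'.IsPrime),
      Nonempty (S ⧸ L.map (algebraMap D S) ≃+* Localization.AtPrime Q') := by
  have hQ : (Q.map (Ideal.Quotient.mk L)).IsPrime := Ideal.isPrime_map_quotientMk_of_isPrime hL
  have hcomap : (Q.map (Ideal.Quotient.mk L)).comap (Ideal.Quotient.mk L) = Q := by
    rw [Ideal.comap_map_of_surjective _ Ideal.Quotient.mk_surjective, ← RingHom.ker_eq_comap_bot,
      Ideal.mk_ker, sup_eq_left.mpr hL]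
  have hM : Algebra.algebraMapSubmonoid (D ⧸ L) Q.primeCompl =
      (Q.map (Ideal.Quotient.mk L)).primeCompl := by
    ext z
    obtain ⟨z, rfl⟩ := Ideal.Quotient.mk_surjective z
    constructor
    · rintro ⟨w, hw, hwz⟩
      rw [← hwz]
      intro h
      exact hw (hcomap ▸ h)
    · intro h
      exact ⟨z, fun hz => h (Ideal.mem_map_of_mem _ hz), rfl⟩
  have hloc : IsLocalization (Algebra.algebraMapSubmonoid (D ⧸ L) Q.primeCompl)
    (S ⧸ L.map (algebraMap D S)) := inferInstance
  rw [hM] at hloc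
  refine ⟨(Q.map (Ideal.Quotient.mk L)).comap (e.symm : T →+* D ⧸ L), inferInstance,
    ⟨IsLocalization.ringEquivOfRingEquiv (M := (Q.map (Ideal.Quotient.mk L)).primeCompl)
    (T := ((Q.map (Ideal.Quotient.mk L)).comap (e.symm : T →+* D ⧸ L)).primeCompl)
    _ _ e ?_⟩⟩
  ext z
  constructor
  · rintro ⟨w, hw, rfl⟩
    intro h
    exact hw (by simpa using h)
  · intro h
    exact ⟨e.symm z, h, by simp⟩

namespace QuadTransform

/-! ### Regularity and normality of the blow-up along the exceptional fibre. -/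

section LocalChart

universe u v

variable {R : Type u} {K : Type v} [CommRing R] [IsRegularLocalRing R] [Field K] [Algebra R K]
  [FaithfulSMul R K] {y : R}

/-- The exceptional fibre at a point of the chart is regular and normal. -/
theorem exceptionalFibre_properties (hy : y ∈ maximalIdeal R)
    (hy2 : y ∉ maximalIdeal R ^ 2) (Q : Ideal (blowupChart R K (maximalIdeal R) y)) [Q.IsPrime]
    (hQ : chartHom R K (maximalIdeal R) y y ∈ Q) {w : (LocalSubring.ofPrime _ Q).toSubring}
    (hw : (w : K) = algebraMap R K y) :
    IsDomain ((LocalSubring.ofPrime _ Q).toSubring ⧸ Ideal.span {w}) ∧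
    IsIntegrallyClosed ((LocalSubring.ofPrime _ Q).toSubring ⧸ Ideal.span {w}) ∧
    IsRegularLocalRing ((LocalSubring.ofPrime _ Q).toSubring ⧸ Ideal.span {w}) := by
  obtain ⟨d, ⟨e⟩⟩ := exists_quotient_equiv_mvPolynomial (K := K) hy hy2
  obtain ⟨Q', hQ', ⟨e'⟩⟩ := IsLocalization.AtPrime.exists_quotient_equiv
    (S := (LocalSubring.ofPrime _ Q).toSubring) Q ((Ideal.span_singleton_le_iff_mem _).mpr hQ) e
  have hmap : (Ideal.span {chartHom R K (maximalIdeal R) y y}).map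
      (algebraMap _ (LocalSubring.ofPrime _ Q).toSubring) = Ideal.span {w} := by
    rw [Ideal.map_span, Set.image_singleton]
    congr 2
    exact Subtype.ext hw.symm
  rw [hmap] at e'
  have h1 : IsDomain (Localization.AtPrime Q') := inferInstance
  have h2 : IsIntegrallyClosed (Localization.AtPrime Q') :=
    isIntegrallyClosed_of_isLocalization _ Q'.primeCompl Q'.primeCompl_le_nonZeroDivisors
  have h3 : IsRegularLocalRing (Localization.AtPrime Q') := inferInstance
  have h1' : IsDomain ((LocalSubring.ofPrime _ Q).toSubring ⧸ Ideal.span {w}) :=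
    e'.toMulEquiv.isDomain _
  exact ⟨h1', .of_equiv e'.symm, .of_ringEquiv e'.symm⟩

theorem isNoetherianRing_ofPrime_chart (hy : y ∈ maximalIdeal R)
    (hy2 : y ∉ maximalIdeal R ^ 2) (Q : Ideal (blowupChart R K (maximalIdeal R) y)) [Q.IsPrime] :
    IsNoetherianRing (LocalSubring.ofPrime _ Q).toSubring :=
  have := isNoetherianRing_blowupChart (K := K) hy hy2
  IsLocalization.isNoetherianRing Q.primeCompl _ this

theorem prime_ofPrime_chart (hy : y ∈ maximalIdeal R)
    (hy2 : y ∉ maximalIdeal R ^ 2) (Q : Ideal (blowupChart R K (maximalIdeal R) y)) [Q.IsPrime]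
    (hQ : chartHom R K (maximalIdeal R) y y ∈ Q) {w : (LocalSubring.ofPrime _ Q).toSubring}
    (hw : (w : K) = algebraMap R K y) : Prime w := by
  have h := (exceptionalFibre_properties hy hy2 Q hQ hw).1
  rw [Ideal.Quotient.isDomain_iff_prime] at h
  refine (Ideal.span_singleton_prime ?_).mp h
  rintro rfl
  exact hy2 ((FaithfulSMul.algebraMap_injective R K (hw.symm.trans (map_zero _).symm)) ▸ zero_mem _)

theorem isIntegrallyClosed_ofPrime_chart (hy : y ∈ maximalIdeal R)
    (hy2 : y ∉ maximalIdeal R ^ 2) (Q : Ideal (blowupChart R K (maximalIdeal R) y)) [Q.IsPrime]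
    (hQ : chartHom R K (maximalIdeal R) y y ∈ Q) :
    IsIntegrallyClosed (LocalSubring.ofPrime _ Q).toSubring := by
  let w : (LocalSubring.ofPrime _ Q).toSubring :=
    ⟨algebraMap R K y, LocalSubring.le_ofPrime _ Q (algebraMap_mem_blowupChart y)⟩
  have := isNoetherianRing_ofPrime_chart hy hy2 Q
  obtain ⟨h1, h2, -⟩ := exceptionalFibre_properties hy hy2 Q hQ (w := w) rfl
  exact isIntegrallyClosed_of_quotient_prime (prime_ofPrime_chart hy hy2 Q hQ (w := w) rfl)

/-- The blow-up of the maximal ideal of a regular local ring is regular along the exceptional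
fibre. -/
theorem isRegularLocalRing_ofPrime_chart (hy : y ∈ maximalIdeal R)
    (hy2 : y ∉ maximalIdeal R ^ 2) (Q : Ideal (blowupChart R K (maximalIdeal R) y)) [Q.IsPrime]
    (hQ : chartHom R K (maximalIdeal R) y y ∈ Q) :
    IsRegularLocalRing (LocalSubring.ofPrime _ Q).toSubring := by
  let w : (LocalSubring.ofPrime _ Q).toSubring :=
    ⟨algebraMap R K y, LocalSubring.le_ofPrime _ Q (algebraMap_mem_blowupChart y)⟩
  have := isNoetherianRing_ofPrime_chart hy hy2 Q
  have hp := prime_ofPrime_chart hy hy2 Q hQ (w := w) rfl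
  obtain ⟨-, -, h3⟩ := exceptionalFibre_properties hy hy2 Q hQ (w := w) rfl
  exact isRegularLocalRing_of_quotient (mem_nonZeroDivisors_of_ne_zero hp.ne_zero)
    ((mem_maximalIdeal w).mpr hp.not_isUnit)

end LocalChart

/-! ### Saturated subrings of a valuation ring and Rees valuation rings -/

section Saturated

variable {K : Type*} [Field K]

/-- A subring `C` of a valuation ring `V` is saturated if it is integrally closed in the field and
contains the inverses of those of its elements that are units of `V`. -/
structure IsSaturatedIn (V : ValuationSubring K) (C : Subring K) : Prop where
  le : C ≤ V.toSubring
  inv_mem : ∀ t ∈ C, t⁻¹ ∈ V → t⁻¹ ∈ C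
  integral_mem : ∀ z : K, IsIntegral C z → z ∈ C

theorem isIntegral_mono {B C : Subring K} (h : B ≤ C) {z : K} (hz : IsIntegral B z) :
    IsIntegral C z := by
  obtain ⟨p, hp, hpz⟩ := hz
  refine ⟨p.map (Subring.inclusion h), hp.map _, ?_⟩
  rw [Polynomial.eval₂_map]
  exact hpz

theorem mem_valuationSubring_of_isIntegral (V : ValuationSubring K) {z : K}
    (hz : IsIntegral V.toSubring z) : z ∈ V := by
  have h : IsIntegral V z := hz
  obtain ⟨w, rfl⟩ := IsIntegrallyClosed.isIntegral_iff.mp h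
  exact w.2

/-- The center of a valuation ring on a subring. -/
def center (V : ValuationSubring K) (B : Subring K) (h : B ≤ V.toSubring) : Ideal B :=
  (maximalIdeal V).comap (Subring.inclusion h : B →+* V)

instance (V : ValuationSubring K) (B : Subring K) (h : B ≤ V.toSubring) :
    (center V B h).IsPrime :=
  inferInstanceAs ((maximalIdeal V).comap (Subring.inclusion h : B →+* V)).IsPrime

theorem mem_center_iff {V : ValuationSubring K} {B : Subring K} {h : B ≤ V.toSubring} {b : B} :
    b ∈ center V B h ↔ V.valuation (b : K) < 1 :=
  V.valuation_lt_one_iff (Subring.inclusion h b)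

theorem notMem_center_iff {V : ValuationSubring K} {B : Subring K} {h : B ≤ V.toSubring} {b : B} :
    b ∉ center V B h ↔ V.valuation (b : K) = 1 := by
  rw [mem_center_iff, not_lt]
  exact ⟨fun h1 => le_antisymm ((V.valuation_le_one_iff _).mpr (h b.2)) h1, fun h1 => h1.ge⟩

/-- Denominators outside the center are units of V, and a fraction whose inverse lies in V has its
numerator outside the center or equal to zero. Only the localization is assumed normal, which is
what is known for charts of the blow-up of 𝔪 along the exceptional fibre. -/
theorem isSaturatedIn_ofPrime_center_of_isIntegral {V : ValuationSubring K} {B : Subring K}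
    (h : B ≤ V.toSubring) (hB : ∀ z : K,
      IsIntegral (LocalSubring.ofPrime B (center V B h)).toSubring z →
        z ∈ (LocalSubring.ofPrime B (center V B h)).toSubring) :
    IsSaturatedIn V (LocalSubring.ofPrime B (center V B h)).toSubring where
  le := by
    intro z hz
    obtain ⟨s, t, ht, rfl⟩ := LocalSubring.mem_ofPrime_iff.mp hz
    change _ ∈ V
    rw [← V.valuation_le_one_iff, map_div₀, notMem_center_iff.mp ht, div_one]
    exact (V.valuation_le_one_iff _).mpr (h s.2)
  inv_mem := by
    intro z hz hz'
    obtain ⟨s, t, ht, rfl⟩ := LocalSubring.mem_ofPrime_iff.mp hz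
    rw [notMem_center_iff] at ht
    by_cases hs : s ∈ center V B h
    · rw [mem_center_iff] at hs
      rw [← V.valuation_le_one_iff, map_inv₀, map_div₀, ht, div_one] at hz'
      by_cases hs0 : (s : K) = 0
      · rw [hs0, zero_div, inv_zero]; exact zero_mem _
      · have : 0 < V.valuation (s : K) := zero_lt_iff.mpr ((V.valuation.ne_zero_iff).mpr hs0)
        exact absurd ((inv_le_one₀ this).mp hz') (not_le.mpr hs)
    · exact LocalSubring.mem_ofPrime_iff.mpr ⟨t, s, hs, inv_div _ _⟩
  integral_mem := hB

theorem isSaturatedIn_ofPrime_center {V : ValuationSubring K} {B : Subring K}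
    (h : B ≤ V.toSubring) (hB : ∀ z : K, IsIntegral B z → z ∈ B) :
    IsSaturatedIn V (LocalSubring.ofPrime B (center V B h)).toSubring := by
  refine isSaturatedIn_ofPrime_center_of_isIntegral h ?_
  intro z hz
  obtain ⟨m, hm⟩ := IsIntegral.exists_multiple_integral_of_isLocalization
    (center V B h).primeCompl z hz
  have hm0 : ((m : B) : K) ≠ 0 := fun h0 => m.2 (by
    rw [show (m : B) = 0 from Subtype.ext h0]; exact zero_mem _)
  refine LocalSubring.mem_ofPrime_iff.mpr ⟨⟨_, hB _ hm⟩, m, m.2, ?_⟩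
  rw [eq_div_iff hm0, mul_comm]
  rfl

/-- The denominators are units of V, so a saturated ring above B already inverts them. This makes
localized normalized charts minimal among saturated rings. -/
theorem IsSaturatedIn.ofPrime_le {V : ValuationSubring K} {B C : Subring K}
    (hC : IsSaturatedIn V C) (hBC : B ≤ C) {P : Ideal B} [P.IsPrime]
    (h : (LocalSubring.ofPrime B P).toSubring ≤ V.toSubring) :
    (LocalSubring.ofPrime B P).toSubring ≤ C := by
  intro z hz
  obtain ⟨s, t, ht, rfl⟩ := LocalSubring.mem_ofPrime_iff.mp hz
  rw [div_eq_mul_inv]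
  exact mul_mem (hBC s.2) (hC.inv_mem _ (hBC t.2)
    (h (LocalSubring.mem_ofPrime_iff.mpr ⟨1, t, ht, by simp⟩)))

end Saturated

/-! ### Rees valuation rings by minimality of saturated subrings. -/

section Rees

variable {A K : Type*} [CommRing A] [Field K] [Algebra A K]

theorem blowupChart_le_normalizedBlowupChart (J : Ideal A) (a : A) :
    blowupChart A K J a ≤ normalizedBlowupChart A K J a := fun z hz =>
  (integralClosure (blowupChart A K J a) K).algebraMap_mem ⟨z, hz⟩

theorem mem_normalizedBlowupChart_of_isIntegral {J : Ideal A} {a : A} {z : K}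
    (hz : IsIntegral (normalizedBlowupChart A K J a) z) : z ∈ normalizedBlowupChart A K J a := by
  have h : IsIntegral (integralClosure (blowupChart A K J a) K) z := hz
  exact isIntegral_trans (R := blowupChart A K J a) z h

theorem normalizedBlowupChart_le {J : Ideal A} {a : A} {C : Subring K}
    (hC : ∀ z : K, IsIntegral C z → z ∈ C) (h : blowupChart A K J a ≤ C) :
    normalizedBlowupChart A K J a ≤ C := fun z hz =>
  hC z (isIntegral_mono h (show IsIntegral (blowupChart A K J a) z from hz))

/-- Rees valuation rings are the discrete valuation rings without proper saturated subrings that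
contain a chart of the blow-up. -/
theorem mem_reesValuationRings_iff [FaithfulSMul A K] {J : Ideal A} {V : ValuationSubring K} :
    V ∈ reesValuationRings A K J ↔ IsDiscreteValuationRing V ∧
      ∃ a ∈ J, a ≠ 0 ∧ blowupChart A K J a ≤ V.toSubring ∧ V.valuation (algebraMap A K a) < 1 ∧
        ∀ C, IsSaturatedIn V C → blowupChart A K J a ≤ C → C = V.toSubring := by
  have hinj := FaithfulSMul.algebraMap_injective A K
  constructor
  · rintro ⟨hV, a, haJ, ha0, P, hP, ⟨z, hzP, hza⟩, hVP⟩
    have hBV : normalizedBlowupChart A K J a ≤ V.toSubring := hVP ▸ LocalSubring.le_ofPrime _ P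
    have hchart := (blowupChart_le_normalizedBlowupChart (K := K) J a).trans hBV
    refine ⟨hV, a, haJ, ha0, hchart, ?_, ?_⟩
    · by_contra hlt
      have haV : algebraMap A K a ∈ V := hchart (algebraMap_mem_blowupChart a)
      have h1 : (algebraMap A K a)⁻¹ ∈ V.toSubring := by
        change _ ∈ V
        rw [← V.valuation_le_one_iff, map_inv₀]
        exact inv_le_one_of_one_le₀ (not_lt.mp hlt)
      rw [hVP] at h1
      obtain ⟨s, t, ht, h2⟩ := LocalSubring.mem_ofPrime_iff.mp h1
      have ha0' : algebraMap A K a ≠ 0 := fun h => ha0 (hinj (h.trans (map_zero _).symm))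
      have ht0 : (t : K) ≠ 0 := fun h0 => ht (by
        rw [show t = 0 from Subtype.ext h0]; exact zero_mem _)
      refine ht ?_
      -- With 1/a = s/t the denominator t equals a s, an element of P.
      have e : t = z * s := by
        apply Subtype.ext
        rw [Subring.coe_mul, hza]
        field_simp at h2
        rw [h2]
      rw [e]
      exact Ideal.mul_mem_right _ _ hzP
    · intro C hC hle
      refine le_antisymm hC.le fun w hw => ?_
      rw [hVP] at hw
      exact hC.ofPrime_le (normalizedBlowupChart_le hC.integral_mem hle) hVP.ge hw
  · rintro ⟨hV, a, haJ, ha0, hchart, hlt, hsat⟩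
    have hBV : normalizedBlowupChart A K J a ≤ V.toSubring :=
      normalizedBlowupChart_le (fun z hz => mem_valuationSubring_of_isIntegral V hz) hchart
    have hle := blowupChart_le_normalizedBlowupChart (K := K) J a
    refine ⟨hV, a, haJ, ha0, center V _ hBV, inferInstance,
      ⟨⟨_, hle (algebraMap_mem_blowupChart a)⟩, mem_center_iff.mpr hlt, rfl⟩, ?_⟩
    -- The localization of the normalized chart at the center is saturated, so minimality identifies
    -- it with V.
    exact (hsat _ (isSaturatedIn_ofPrime_center hBV
      fun z hz => mem_normalizedBlowupChart_of_isIntegral hz)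
      (hle.trans (LocalSubring.le_ofPrime _ _))).symm

theorem div_mem_iff_valuation_le {V : ValuationSubring K} {b a : K} (ha : a ≠ 0) :
    b / a ∈ V ↔ V.valuation b ≤ V.valuation a := by
  rw [← V.valuation_le_one_iff, map_div₀,
    div_le_one₀ (zero_lt_iff.mpr ((V.valuation.ne_zero_iff).mpr ha))]

/-- A Noetherian ideal contains an element that generates its extension to a valuation ring. -/
theorem exists_forall_valuation_le [FaithfulSMul A K] [IsNoetherianRing A]
    {V : ValuationSubring K} (hA : ∀ r, algebraMap A K r ∈ V) {J : Ideal A} (hJ : J ≠ ⊥) :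
    ∃ a ∈ J, a ≠ 0 ∧ ∀ b ∈ J, V.valuation (algebraMap A K b) ≤ V.valuation (algebraMap A K a) := by
  obtain ⟨s, rfl⟩ := J.fg_of_isNoetherianRing
  have hs : s.Nonempty := by
    rw [Finset.nonempty_iff_ne_empty]
    rintro rfl
    exact hJ (by simp)
  obtain ⟨a, ha, hmax⟩ := s.exists_max_image (fun b => V.valuation (algebraMap A K b)) hs
  have hle : ∀ b ∈ Ideal.span (s : Set A),
      V.valuation (algebraMap A K b) ≤ V.valuation (algebraMap A K a) := by
    intro b hb
    induction hb using Submodule.span_induction with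
    | mem b hb => exact hmax b hb
    | zero => simp
    | add b c _ _ hb hc => rw [map_add]; exact (V.valuation.map_add _ _).trans (max_le hb hc)
    | smul r b _ hb =>
      rw [smul_eq_mul, map_mul, map_mul]
      exact (mul_le_of_le_one_left' ((V.valuation_le_one_iff _).mpr (hA r))).trans hb
  refine ⟨a, Ideal.subset_span ha, ?_, hle⟩
  rintro rfl
  refine hJ (le_bot_iff.mp fun b hb => ?_)
  have h := hle b hb
  rw [map_zero, map_zero, le_zero_iff, V.valuation.zero_iff] at h
  exact FaithfulSMul.algebraMap_injective A K (h.trans (map_zero _).symm)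

theorem blowupChart_le_valuationSubring {V : ValuationSubring K}
    (hA : ∀ r, algebraMap A K r ∈ V) {J : Ideal A} {a : A} (ha : algebraMap A K a ≠ 0)
    (hle : ∀ b ∈ J, V.valuation (algebraMap A K b) ≤ V.valuation (algebraMap A K a)) :
    blowupChart A K J a ≤ V.toSubring :=
  blowupChart_le hA fun b hb => (div_mem_iff_valuation_le ha).mpr (hle b hb)

/-- Any generator of the extension of `J` to a Rees valuation ring gives a chart that contains its
center. -/
theorem eq_of_mem_reesValuationRings [FaithfulSMul A K] {J : Ideal A} {V : ValuationSubring K}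
    (hV : V ∈ reesValuationRings A K J) {a : A} (haJ : a ∈ J) (ha : algebraMap A K a ≠ 0)
    {C : Subring K} (hC : IsSaturatedIn V C) (hCa : blowupChart A K J a ≤ C) :
    C = V.toSubring := by
  obtain ⟨-, a', haJ', ha0', hchart, -, hsat⟩ := mem_reesValuationRings_iff.mp hV
  have ha' : algebraMap A K a' ≠ 0 := fun h =>
    ha0' (FaithfulSMul.algebraMap_injective A K (h.trans (map_zero _).symm))
  refine hsat C hC (blowupChart_le (fun r => hCa (algebraMap_mem_blowupChart r)) fun b hb => ?_)
  -- Both a and a' generate the extension of J to V, so their quotient is a unit of V and saturation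
  -- allows the change of chart.
  have h1 : (algebraMap A K a' / algebraMap A K a)⁻¹ ∈ C := by
    refine hC.inv_mem _ (hCa (div_mem_blowupChart haJ')) ?_
    rw [inv_div]
    exact hchart (div_mem_blowupChart haJ)
  have e : algebraMap A K b / algebraMap A K a' =
      algebraMap A K b / algebraMap A K a * (algebraMap A K a' / algebraMap A K a)⁻¹ := by
    field_simp
  rw [e]
  exact mul_mem (hCa (div_mem_blowupChart hb)) h1

theorem algebraMap_mem_of_mem_reesValuationRings [FaithfulSMul A K] {J : Ideal A}
    {V : ValuationSubring K} (hV : V ∈ reesValuationRings A K J) (r : A) :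
    algebraMap A K r ∈ V := by
  obtain ⟨-, a, -, -, hchart, -⟩ := mem_reesValuationRings_iff.mp hV
  exact hchart (algebraMap_mem_blowupChart r)

theorem valuation_lt_one_of_mem_reesValuationRings [FaithfulSMul A K] {J : Ideal A}
    {V : ValuationSubring K} (hV : V ∈ reesValuationRings A K J) {b : A} (hb : b ∈ J) :
    V.valuation (algebraMap A K b) < 1 := by
  obtain ⟨-, a, -, ha0, hchart, hlt, -⟩ := mem_reesValuationRings_iff.mp hV
  have ha : algebraMap A K a ≠ 0 := fun h =>
    ha0 (FaithfulSMul.algebraMap_injective A K (h.trans (map_zero _).symm))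
  exact ((div_mem_iff_valuation_le ha).mp (hchart (div_mem_blowupChart hb))).trans_lt hlt

/-- The Rees valuation rings of an ideal are Rees valuation rings of its multiples. -/
theorem reesValuationRings_subset_mul [FaithfulSMul A K] [IsNoetherianRing A] [IsDomain A]
    (J₁ : Ideal A) {J₂ : Ideal A} (hJ₂ : J₂ ≠ ⊥) :
    reesValuationRings A K J₁ ⊆ reesValuationRings A K (J₁ * J₂) := by
  intro V hV
  have hinj := FaithfulSMul.algebraMap_injective A K
  have hA := algebraMap_mem_of_mem_reesValuationRings hV
  obtain ⟨hdvr, a, haJ, ha0, hchart, hlt, hsat⟩ := mem_reesValuationRings_iff.mp hV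
  -- With g generating J₂V, the chart at `a * g` contains b/a = bg/(ag), hence the chart of J₁ at a.
  obtain ⟨g, hg, hg0, hgle⟩ := exists_forall_valuation_le hA hJ₂
  have ha : algebraMap A K a ≠ 0 := fun h => ha0 (hinj (h.trans (map_zero _).symm))
  have hg' : algebraMap A K g ≠ 0 := fun h => hg0 (hinj (h.trans (map_zero _).symm))
  refine mem_reesValuationRings_iff.mpr ⟨hdvr, a * g, Ideal.mul_mem_mul haJ hg,
    mul_ne_zero ha0 hg0, ?_, ?_, ?_⟩
  · refine blowupChart_le_valuationSubring hA (by rw [map_mul]; exact mul_ne_zero ha hg') ?_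
    intro b hb
    induction hb using Submodule.mul_induction_on' with
    | mem_mul_mem b hb c hc =>
      rw [map_mul, map_mul, map_mul, map_mul]
      exact mul_le_mul' ((div_mem_iff_valuation_le ha).mp (hchart (div_mem_blowupChart hb)))
        (hgle c hc)
    | add b _ c _ hb hc => rw [map_add]; exact (V.valuation.map_add _ _).trans (max_le hb hc)
  · rw [map_mul, map_mul]
    exact mul_lt_one_of_lt_of_le hlt ((V.valuation_le_one_iff _).mpr (hA g))
  · intro C hC hCle
    refine hsat C hC (blowupChart_le (fun r => hCle (algebraMap_mem_blowupChart r)) fun b hb => ?_)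
    have h := hCle (div_mem_blowupChart (Ideal.mul_mem_mul hb hg))
    rwa [map_mul, map_mul, mul_div_mul_right _ _ hg'] at h

end Rees

/-! ### The order valuation ring -/

theorem natCast_le_order_iff {A : Type*} [CommRing A] [IsLocalRing A] {x : A} {n : ℕ} :
    (n : ℕ∞) ≤ order A x ↔ x ∈ maximalIdeal A ^ n := by
  constructor
  · intro h
    rcases n with _ | n
    · simp
    · have h1 : (n : ℕ∞) < order A x := lt_of_lt_of_le (by exact_mod_cast n.lt_succ_self) h
      simp only [order, lt_iSup_iff] at h1
      obtain ⟨j, hj, hnj⟩ := h1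
      exact Ideal.pow_le_pow_right (by exact_mod_cast hnj) hj
  · exact fun h => le_iSup₂_of_le n h le_rfl

theorem exists_mem_pow_notMem_pow_succ {A : Type*} [CommRing A] [IsLocalRing A]
    [IsNoetherianRing A] {x : A} (hx : x ≠ 0) :
    ∃ n, x ∈ maximalIdeal A ^ n ∧ x ∉ maximalIdeal A ^ (n + 1) := by
  by_contra! h
  refine hx ?_
  rw [← Ideal.mem_bot, ← Ideal.iInf_pow_eq_bot_of_isLocalRing (maximalIdeal A)
    (maximalIdeal.isMaximal _).ne_top, Ideal.mem_iInf]
  intro n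
  induction n with
  | zero => simp
  | succ n ih => exact h n ih

/-- A discrete valuation ring has no proper overrings other than the field. -/
theorem eq_of_le_of_isDiscreteValuationRing {K : Type*} [Field K] {V W : ValuationSubring K}
    [IsDiscreteValuationRing V] (h : V ≤ W) (hW : W ≠ ⊤) : V = W := by
  refine le_antisymm h fun w hw => ?_
  by_contra hwV
  refine hW (top_le_iff.mp fun k _ => ?_)
  obtain ⟨ϖ, hϖ⟩ := IsDiscreteValuationRing.exists_irreducible V
  have hwi : w⁻¹ ∈ V := (V.mem_or_inv_mem w).resolve_left hwV
  have hw0 : w ≠ 0 := fun h0 => hwV (h0 ▸ zero_mem _)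
  -- As 1/w is a nonunit of V, every nonzero b ∈ V divides a power of 1/w. Hence a/b is an element
  -- of V times a power of w.
  have hdvd : ϖ ∣ (⟨w⁻¹, hwi⟩ : V) := by
    rw [← Ideal.mem_span_singleton, ← hϖ.maximalIdeal_eq, mem_maximalIdeal]
    intro hu
    obtain ⟨u, hu⟩ := hu.exists_right_inv
    refine hwV ?_
    have h1 : w⁻¹ * (u : K) = 1 := congrArg Subtype.val hu
    have h2 : (u : K) = w := by field_simp at h1; exact h1
    exact h2 ▸ u.2
  obtain ⟨a, b, hb, rfl⟩ := IsFractionRing.div_surjective (A := V) k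
  obtain ⟨j, hj⟩ := IsDiscreteValuationRing.associated_pow_irreducible
    (nonZeroDivisors.ne_zero hb) hϖ
  obtain ⟨c, hc⟩ := hj.dvd.trans (pow_dvd_pow_of_dvd hdvd j)
  have hc' : w⁻¹ ^ j = (b : K) * c := congrArg Subtype.val hc
  have hb0 : (b : K) ≠ 0 := fun h0 => nonZeroDivisors.ne_zero hb (Subtype.ext h0)
  have e : (algebraMap V K a / algebraMap V K b : K) = a * c * w ^ j := by
    change (a : K) / b = _
    have : (c : K) * w ^ j = (b : K)⁻¹ := by
      have h3 : (b : K) * (c * w ^ j) = 1 := by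
        rw [← mul_assoc, ← hc', ← mul_pow, inv_mul_cancel₀ hw0, one_pow]
      exact eq_inv_of_mul_eq_one_right h3
    rw [mul_assoc, this, div_eq_mul_inv]
  rw [e]
  exact mul_mem (mul_mem (h a.2) (h c.2)) (pow_mem hw j)

section OrderValuation

universe u v

variable {R : Type u} {K : Type v} [CommRing R] [IsRegularLocalRing R] [Field K] [Algebra R K]
  {y : R}

theorem prime_chartHom [FaithfulSMul R K] (hy : y ∈ maximalIdeal R) (hy2 : y ∉ maximalIdeal R ^ 2) :
    Prime (chartHom R K (maximalIdeal R) y y) := by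
  obtain ⟨d, ⟨e⟩⟩ := exists_quotient_equiv_mvPolynomial (K := K) hy hy2
  have h : IsDomain (blowupChart R K (maximalIdeal R) y ⧸
    Ideal.span {chartHom R K (maximalIdeal R) y y}) := e.toMulEquiv.isDomain _
  rw [Ideal.Quotient.isDomain_iff_prime] at h
  refine (Ideal.span_singleton_prime fun h0 => hy2 ?_).mp h
  have h1 : algebraMap R K y = 0 := congrArg Subtype.val h0
  exact (FaithfulSMul.algebraMap_injective R K (h1.trans (map_zero _).symm)) ▸ zero_mem _

theorem algebraMap_ne_zero_of_notMem_sq [FaithfulSMul R K] (hy2 : y ∉ maximalIdeal R ^ 2) : algebraMap R K y ≠ 0 :=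
  fun h => hy2 ((FaithfulSMul.algebraMap_injective R K (h.trans (map_zero _).symm)) ▸ zero_mem _)

/-- Denominators outside Q are not divisible by the prime y ∈ Q, so divisibility of f by y^n
descends from the local ring to the chart. Orders can thus be read off at any point of the
exceptional fibre. -/
theorem mem_pow_of_div_pow_mem_ofPrime [FaithfulSMul R K] (hy : y ∈ maximalIdeal R) (hy2 : y ∉ maximalIdeal R ^ 2)
    {Q : Ideal (blowupChart R K (maximalIdeal R) y)} [Q.IsPrime]
    (hQ : chartHom R K (maximalIdeal R) y y ∈ Q) {f : R} {n : ℕ}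
    (h : algebraMap R K f / algebraMap R K y ^ n ∈ (LocalSubring.ofPrime _ Q).toSubring) :
    f ∈ maximalIdeal R ^ n := by
  have hy0 : algebraMap R K y ≠ 0 := algebraMap_ne_zero_of_notMem_sq hy2
  obtain ⟨s, t, ht, hst⟩ := LocalSubring.mem_ofPrime_iff.mp h
  have ht0 : (t : K) ≠ 0 := fun h0 => ht (by
    rw [show t = 0 from Subtype.ext h0]; exact zero_mem _)
  have e : chartHom R K (maximalIdeal R) y y ^ n * s =
      t * chartHom R K (maximalIdeal R) y f := by
    apply Subtype.ext
    simp only [Subring.coe_mul, Subring.coe_pow, coe_chartHom]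
    rw [div_eq_div_iff (pow_ne_zero n hy0) ht0] at hst
    rw [mul_comm, ← hst, mul_comm]
  obtain ⟨z, hz⟩ := (prime_chartHom hy hy2).pow_dvd_of_dvd_mul_left n
    (fun ⟨c, hc⟩ => ht (hc ▸ Ideal.mul_mem_right _ _ hQ)) (Dvd.intro _ e)
  exact mem_pow_of_eq_pow_mul hy hy2 z.2 (congrArg Subtype.val hz)

/-- The exceptional prime divisor of the blow-up of the maximal ideal is a discrete valuation ring,
namely the order valuation ring. -/
theorem exists_isOrderValuationRing [IsDomain R] [IsFractionRing R K] (hy : y ∈ maximalIdeal R)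
    (hy2 : y ∉ maximalIdeal R ^ 2) :
    ∃ W : ValuationSubring K, IsOrderValuationRing R K W ∧ IsDiscreteValuationRing W ∧
      ∃ (P : Ideal (blowupChart R K (maximalIdeal R) y)) (_ : P.IsPrime),
        P = Ideal.span {chartHom R K (maximalIdeal R) y y} ∧
        W.toSubring = (LocalSubring.ofPrime _ P).toSubring := by
  have hinj := FaithfulSMul.algebraMap_injective R K
  have hyp := prime_chartHom (K := K) hy hy2
  have hy0 : algebraMap R K y ≠ 0 := fun h => hyp.ne_zero (Subtype.ext h)
  set P := Ideal.span {chartHom R K (maximalIdeal R) y y} with hPdef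
  have hP : P.IsPrime := (Ideal.span_singleton_prime hyp.ne_zero).mpr hyp
  have hyP : chartHom R K (maximalIdeal R) y y ∈ P := Ideal.mem_span_singleton_self _
  let S := (LocalSubring.ofPrime _ P).toSubring
  have hnoeth : IsNoetherianRing S := isNoetherianRing_ofPrime_chart hy hy2 P
  -- S is a Noetherian local domain whose maximal ideal is generated by y.
  have hprinc : (maximalIdeal S).IsPrincipal := by
    rw [← IsLocalization.AtPrime.map_eq_maximalIdeal P S]
    exact ⟨_, (Ideal.map_span (algebraMap _ S) {chartHom R K (maximalIdeal R) y y}).trans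
      (congrArg Ideal.span Set.image_singleton)⟩
  have hpid : IsPrincipalIdealRing S :=
    ((tfae_of_isNoetherianRing_of_isLocalRing_of_isDomain S).out 4 0 rfl rfl).mp hprinc
  have hvr : ValuationRing S :=
    ((tfae_of_isNoetherianRing_of_isLocalRing_of_isDomain S).out 4 1 rfl rfl).mp hprinc
  have hRS : ∀ r, algebraMap R K r ∈ S := fun r =>
    LocalSubring.le_ofPrime _ P (algebraMap_mem_blowupChart r)
  have hprimeS := prime_ofPrime_chart hy hy2 P hyP (w := ⟨algebraMap R K y, hRS y⟩) rfl
  have hdvr : IsDiscreteValuationRing S :=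
    { not_a_field' := fun h => hprimeS.ne_zero (by
        rw [← Ideal.mem_bot, ← h, mem_maximalIdeal]
        exact hprimeS.not_isUnit) }
  let W : ValuationSubring K := { S with
    mem_or_inv_mem' := by
      intro k
      obtain ⟨f, g, hg, rfl⟩ := IsFractionRing.div_surjective (A := R) k
      have hg0 : algebraMap R K g ≠ 0 := fun h =>
        nonZeroDivisors.ne_zero hg (hinj (h.trans (map_zero _).symm))
      by_cases hf0 : algebraMap R K f = 0
      · left; rw [hf0, zero_div]; exact S.zero_mem
      obtain ⟨c, hc | hc⟩ := ValuationRing.cond (⟨_, hRS f⟩ : S) ⟨_, hRS g⟩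
      · right
        have h1 : algebraMap R K f * c = algebraMap R K g := congrArg Subtype.val hc
        rw [inv_div, ← h1, mul_div_cancel_left₀ _ hf0]
        exact c.2
      · left
        have h1 : algebraMap R K g * c = algebraMap R K f := congrArg Subtype.val hc
        rw [← h1, mul_div_cancel_left₀ _ hg0]
        exact c.2 }
  have hW : W.toSubring = S := rfl
  have hDW : blowupChart R K (maximalIdeal R) y ≤ W.toSubring := LocalSubring.le_ofPrime _ P
  have hpow : ∀ (f : R) (n : ℕ), f ∈ maximalIdeal R ^ n ↔
      W.valuation (algebraMap R K f) ≤ W.valuation (algebraMap R K y ^ n) := by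
    intro f n
    rw [← div_mem_iff_valuation_le (pow_ne_zero n hy0)]
    exact ⟨fun h => hDW (div_pow_mem_blowupChart h),
      fun h => mem_pow_of_div_pow_mem_ofPrime hy hy2 hyP h⟩
  refine ⟨W, ?_, hdvr, P, hP, rfl, hW⟩
  intro f g hg
  have hg0 : algebraMap R K g ≠ 0 := fun h => hg (hinj (h.trans (map_zero _).symm))
  obtain ⟨n, hn, hn1⟩ := exists_mem_pow_notMem_pow_succ hg
  have hog : order R g = n := by
    refine le_antisymm ?_ (natCast_le_order_iff.mpr hn)
    rw [← not_lt]
    intro h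
    exact hn1 (natCast_le_order_iff.mp (by exact_mod_cast Order.add_one_le_of_lt h))
  -- For g of exact order n, y does not divide g/y^n in the chart, so g/y^n is a unit of W.
  have hgn : W.valuation (algebraMap R K g) = W.valuation (algebraMap R K y ^ n) := by
    refine le_antisymm ((hpow g n).mp hn) ?_
    rw [← div_mem_iff_valuation_le hg0]
    refine LocalSubring.mem_ofPrime_iff.mpr ⟨1, ⟨_, div_pow_mem_blowupChart hn⟩, fun h => ?_,
      by simp⟩
    obtain ⟨z, hz⟩ := Ideal.mem_span_singleton.mp h
    refine hn1 (mem_pow_of_eq_pow_mul hy hy2 z.2 ?_)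
    have h1 : algebraMap R K g / algebraMap R K y ^ n = algebraMap R K y * z :=
      congrArg Subtype.val hz
    rw [div_eq_iff (pow_ne_zero n hy0)] at h1
    rw [h1]
    ring
  rw [div_mem_iff_valuation_le hg0, hgn, ← hpow, hog, natCast_le_order_iff]

end OrderValuation

/-! ### Transforms and base points -/

section Transform

universe u v

theorem div_mem_of_mem_extension {A K : Type*} [CommRing A] [Field K] [Algebra A K] {I : Ideal A}
    {S C : Subring K} (hS : S ≤ C) {a : K} (hI : ∀ b ∈ I, algebraMap A K b / a ∈ C) {s : S}
    (hs : s ∈ extension I S) : (s : K) / a ∈ C := by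
  induction hs using Submodule.span_induction with
  | mem s hs =>
    obtain ⟨b, hb, e⟩ := hs
    exact e ▸ hI b hb
  | zero => simp
  | add s t _ _ h1 h2 => rw [Subring.coe_add, add_div]; exact add_mem h1 h2
  | smul c s _ h =>
    rw [smul_eq_mul, Subring.coe_mul, mul_div_assoc]
    exact mul_mem (hS c.2) h

variable {R : Type u} {K : Type v} [CommRing R] [IsRegularLocalRing R] [Field K] [Algebra R K]
  [FaithfulSMul R K] {y : R}

variable {Q : Ideal (blowupChart R K (maximalIdeal R) y)} [Q.IsPrime] {I : Ideal R} {r N : ℕ}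

/-- The smallest principal ideal containing IS is generated by y^r. Indeed a generator c of a
principal ideal containing IS divides y^N; as y is prime, c is associated to some y^j, and then I ⊆
𝔪^j gives j ≤ r. -/
theorem mem_transform_iff (hy : y ∈ maximalIdeal R) (hy2 : y ∉ maximalIdeal R ^ 2)
    (hQ : chartHom R K (maximalIdeal R) y y ∈ Q) (hI : I ≤ maximalIdeal R ^ r)
    (hI' : ¬ I ≤ maximalIdeal R ^ (r + 1)) (hN : maximalIdeal R ^ N ≤ I)
    {s w : (LocalSubring.ofPrime _ Q).toSubring} (hw : (w : K) = algebraMap R K y) :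
    s ∈ transform I (LocalSubring.ofPrime _ Q).toSubring ↔
      s * w ^ r ∈ extension I (LocalSubring.ofPrime _ Q).toSubring := by
  have hy0 : algebraMap R K y ≠ 0 := algebraMap_ne_zero_of_notMem_sq hy2
  have hp := prime_ofPrime_chart hy hy2 Q hQ hw
  have hleast : IsLeast {L : Ideal (LocalSubring.ofPrime _ Q).toSubring |
      L.IsPrincipal ∧ extension I (LocalSubring.ofPrime _ Q).toSubring ≤ L}
      (Ideal.span {w ^ r}) := by
    refine ⟨⟨⟨_, rfl⟩, ?_⟩, ?_⟩
    · refine Ideal.span_le.mpr ?_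
      rintro t ⟨b, hb, e⟩
      refine Ideal.mem_span_singleton.mpr ⟨⟨_, LocalSubring.le_ofPrime _ Q
        (div_pow_mem_blowupChart (hI hb))⟩, Subtype.ext ?_⟩
      rw [Subring.coe_mul, Subring.coe_pow, hw, e, mul_div_cancel₀ _ (pow_ne_zero r hy0)]
    · rintro L ⟨⟨c, rfl⟩, hL⟩
      have hdvd : ∀ t ∈ extension I (LocalSubring.ofPrime _ Q).toSubring, c ∣ t := fun t ht =>
        Ideal.mem_span_singleton.mp (hL ht)
      have hcN : c ∣ w ^ N := hdvd _ (Ideal.subset_span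
        ⟨y ^ N, hN (Ideal.pow_mem_pow hy N), by rw [Subring.coe_pow, hw, map_pow]⟩)
      obtain ⟨j, -, hj⟩ := (dvd_prime_pow hp N).mp hcN
      have hIj : I ≤ maximalIdeal R ^ j := by
        intro b hb
        obtain ⟨t, ht⟩ := hj.symm.dvd.trans (hdvd ⟨algebraMap R K b,
          LocalSubring.le_ofPrime _ Q (algebraMap_mem_blowupChart b)⟩
          (Ideal.subset_span ⟨b, hb, rfl⟩))
        refine mem_pow_of_div_pow_mem_ofPrime hy hy2 hQ (n := j) ?_
        have ht' : algebraMap R K b = algebraMap R K y ^ j * t := by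
          have := congrArg Subtype.val ht
          rwa [Subring.coe_mul, Subring.coe_pow, hw] at this
        rw [ht', mul_div_cancel_left₀ _ (pow_ne_zero j hy0)]
        exact t.2
      have hjr : j ≤ r := by
        by_contra h
        exact hI' (hIj.trans (Ideal.pow_le_pow_right (by omega)))
      change Ideal.span {w ^ r} ≤ Ideal.span {c}
      rw [Ideal.span_singleton_le_span_singleton]
      exact hj.dvd.trans (pow_dvd_pow w hjr)
  constructor
  · exact fun hs => hs _ hleast
  · intro hs c hc
    have h1 : Ideal.span {c} = Ideal.span {w ^ r} := hc.unique hleast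
    obtain ⟨u, hu⟩ := Ideal.span_singleton_le_span_singleton.mp h1.le
    rw [hu, ← mul_assoc]
    exact Ideal.mul_mem_right _ _ hs

/-- The transform is proper at a point of the exceptional fibre if and only if the point lies in the
zero set of the elements `b / y ^ r`. -/
theorem transform_ne_top_iff (hy : y ∈ maximalIdeal R) (hy2 : y ∉ maximalIdeal R ^ 2)
    (hQ : chartHom R K (maximalIdeal R) y y ∈ Q) (hI : I ≤ maximalIdeal R ^ r)
    (hI' : ¬ I ≤ maximalIdeal R ^ (r + 1)) (hN : maximalIdeal R ^ N ≤ I) :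
    transform I (LocalSubring.ofPrime _ Q).toSubring ≠ ⊤ ↔
      ∀ z : blowupChart R K (maximalIdeal R) y, (∃ b ∈ I,
        (z : K) = algebraMap R K b / algebraMap R K y ^ r) → z ∈ Q := by
  have hy0 : algebraMap R K y ≠ 0 := algebraMap_ne_zero_of_notMem_sq hy2
  let w : (LocalSubring.ofPrime _ Q).toSubring :=
    ⟨algebraMap R K y, LocalSubring.le_ofPrime _ Q (algebraMap_mem_blowupChart y)⟩
  have hp := prime_ofPrime_chart hy hy2 Q hQ (w := w) rfl
  rw [Ne, Ideal.eq_top_iff_one, mem_transform_iff hy hy2 hQ hI hI' hN (w := w) rfl, one_mul]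
  constructor
  · rintro h z ⟨b, hb, hz⟩
    by_contra hzQ
    obtain ⟨u, hu⟩ := (IsLocalization.map_units (LocalSubring.ofPrime _ Q).toSubring
      (⟨z, hzQ⟩ : Q.primeCompl)).exists_right_inv
    have hu' : (z : K) * u = 1 := congrArg Subtype.val hu
    refine h ?_
    have e : w ^ r = u * ⟨algebraMap R K b,
        LocalSubring.le_ofPrime _ Q (algebraMap_mem_blowupChart b)⟩ := by
      apply Subtype.ext
      change algebraMap R K y ^ r = (u : K) * algebraMap R K b
      rw [eq_div_iff (pow_ne_zero r hy0)] at hz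
      rw [← hz, ← mul_assoc, mul_comm (u : K), hu', one_mul]
    rw [e]
    exact Ideal.mul_mem_left _ _ (Ideal.subset_span ⟨b, hb, rfl⟩)
  · intro h hmem
    -- If all b/y^r are nonunits, then IS lies in y^r times the maximal ideal, so y^r ∉ IS.
    have hle : extension I (LocalSubring.ofPrime _ Q).toSubring ≤
        Ideal.span {w ^ r} * maximalIdeal (LocalSubring.ofPrime _ Q).toSubring := by
      refine Ideal.span_le.mpr ?_
      rintro t ⟨b, hb, e⟩
      have h1 := h ⟨_, div_pow_mem_blowupChart (hI hb)⟩ ⟨b, hb, rfl⟩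
      have h2 := (IsLocalization.AtPrime.to_map_mem_maximal_iff
        (LocalSubring.ofPrime _ Q).toSubring Q _).mpr h1
      refine Ideal.mem_span_singleton_mul.mpr ⟨_, h2, Subtype.ext ?_⟩
      rw [e]
      exact mul_div_cancel₀ _ (pow_ne_zero r hy0)
    obtain ⟨t, ht, e⟩ := Ideal.mem_span_singleton_mul.mp (hle hmem)
    have ht1 : t = 1 := mul_left_cancel₀ (pow_ne_zero r hp.ne_zero) (e.trans (mul_one _).symm)
    exact (maximalIdeal.isMaximal _).ne_top ((Ideal.eq_top_iff_one _).mpr (ht1 ▸ ht))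

/-- Points of the exceptional fibre are local quadratic transforms. -/
theorem isLocalQuadraticTransform_ofPrime (hy : y ∈ maximalIdeal R)
    (hy2 : y ∉ maximalIdeal R ^ 2) (hQ : chartHom R K (maximalIdeal R) y y ∈ Q) :
    IsLocalQuadraticTransform R K (LocalSubring.ofPrime _ Q) := by
  have hy0 : algebraMap R K y ≠ 0 := algebraMap_ne_zero_of_notMem_sq hy2
  refine ⟨⟨?_, ⟨?_⟩⟩, y, hy, fun h => hy0 (h ▸ map_zero _), Q, ‹_›, rfl⟩
  · rintro _ ⟨f, rfl⟩
    exact LocalSubring.le_ofPrime _ Q (algebraMap_mem_blowupChart f)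
  · rintro ⟨_, f, rfl⟩ hu
    by_cases hf : IsUnit f
    · exact hf.map (algebraMap R K).rangeRestrict
    · exfalso
      have hfm : f ∈ maximalIdeal R := (mem_maximalIdeal f).mpr hf
      have h1 : chartHom R K (maximalIdeal R) y f ∈ Q := by
        have e : chartHom R K (maximalIdeal R) y f = chartHom R K (maximalIdeal R) y y *
            ⟨_, div_mem_blowupChart hfm⟩ := Subtype.ext (mul_div_cancel₀ _ hy0).symm
        rw [e]
        exact Ideal.mul_mem_right _ _ hQ
      exact (mem_maximalIdeal _).mp ((IsLocalization.AtPrime.to_map_mem_maximal_iff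
        (LocalSubring.ofPrime _ Q).toSubring Q _).mpr h1) hu

theorem ofPrime_mem_firstBasePoints (hy : y ∈ maximalIdeal R) (hy2 : y ∉ maximalIdeal R ^ 2)
    (hQ : chartHom R K (maximalIdeal R) y y ∈ Q) (hI : I ≤ maximalIdeal R ^ r)
    (hI' : ¬ I ≤ maximalIdeal R ^ (r + 1)) (hN : maximalIdeal R ^ N ≤ I)
    (h : ∀ z : blowupChart R K (maximalIdeal R) y, (∃ b ∈ I,
        (z : K) = algebraMap R K b / algebraMap R K y ^ r) → z ∈ Q) :
    LocalSubring.ofPrime _ Q ∈ firstBasePoints K I := by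
  have hy0 : algebraMap R K y ≠ 0 := algebraMap_ne_zero_of_notMem_sq hy2
  refine ⟨⟨isLocalQuadraticTransform_ofPrime hy hy2 hQ,
    isRegularLocalRing_ofPrime_chart hy hy2 Q hQ, ?_⟩,
    (transform_ne_top_iff hy hy2 hQ hI hI' hN).mpr h⟩
  let w : (LocalSubring.ofPrime _ Q).toSubring :=
    ⟨algebraMap R K y, LocalSubring.le_ofPrime _ Q (algebraMap_mem_blowupChart y)⟩
  have hp := prime_ofPrime_chart hy hy2 Q hQ (w := w) rfl
  have hnoeth := isNoetherianRing_ofPrime_chart (K := K) hy hy2 Q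
  have hdom := (exceptionalFibre_properties hy hy2 Q hQ (w := w) rfl).1
  rw [← ringKrullDim_quotient_span_singleton_succ_eq_ringKrullDim_of_mem_nonZeroDivisors
    (mem_nonZeroDivisors_of_ne_zero hp.ne_zero) ((mem_maximalIdeal w).mpr hp.not_isUnit)]
  -- In fibre dimension zero y would generate the maximal ideal; the nonunits b/y^r would be
  -- divisible by y, forcing I ⊆ 𝔪^(r+1).
  have h1 : 1 ≤ ringKrullDim ((LocalSubring.ofPrime _ Q).toSubring ⧸ Ideal.span {w}) := by
    by_contra hlt
    have hf : IsField ((LocalSubring.ofPrime _ Q).toSubring ⧸ Ideal.span {w}) :=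
      have : Ring.KrullDimLE 0 ((LocalSubring.ofPrime _ Q).toSubring ⧸ Ideal.span {w}) :=
        Ring.krullDimLE_iff.mpr
          (ENat.WithBot.lt_add_one_iff.mp (by simpa using not_le.mp hlt))
      Ring.KrullDimLE.isField_of_isDomain
    have hmax : (Ideal.span {w}).IsMaximal := Ideal.Quotient.maximal_of_isField _ hf
    have hmax' := IsLocalRing.eq_maximalIdeal hmax
    refine hI' fun b hb => mem_pow_of_div_pow_mem_ofPrime hy hy2 hQ ?_
    have hbQ := h ⟨_, div_pow_mem_blowupChart (hI hb)⟩ ⟨b, hb, rfl⟩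
    have h2 := (IsLocalization.AtPrime.to_map_mem_maximal_iff
        (LocalSubring.ofPrime _ Q).toSubring Q _).mpr hbQ
    rw [← hmax', Ideal.mem_span_singleton] at h2
    obtain ⟨t, ht⟩ := h2
    have ht' : algebraMap R K b / algebraMap R K y ^ r = algebraMap R K y * t :=
      congrArg Subtype.val ht
    rw [pow_succ, ← div_div, ht', mul_div_cancel_left₀ _ hy0]
    exact t.2
  exact add_le_add_left h1 1

/-- Every base point in the first neighborhood is a point of the exceptional fibre in a chart
belonging to an element of order one. -/
theorem exists_of_mem_firstBasePoints {S : LocalSubring K} (hI : I ≤ maximalIdeal R ^ r)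
    (hI' : ¬ I ≤ maximalIdeal R ^ (r + 1)) (hN : maximalIdeal R ^ N ≤ I)
    (hS : S ∈ firstBasePoints K I) :
    ∃ y ∈ maximalIdeal R, y ∉ maximalIdeal R ^ 2 ∧
      ∃ (Q : Ideal (blowupChart R K (maximalIdeal R) y)) (_ : Q.IsPrime),
        chartHom R K (maximalIdeal R) y y ∈ Q ∧ S = LocalSubring.ofPrime _ Q ∧
        ∀ z : blowupChart R K (maximalIdeal R) y, (∃ b ∈ I,
          (z : K) = algebraMap R K b / algebraMap R K y ^ r) → z ∈ Q := by
  obtain ⟨⟨⟨⟨hle, hloc⟩, x, hx, hx0, P, hP, rfl⟩, -, -⟩, htop⟩ := hS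
  have hinj := FaithfulSMul.algebraMap_injective R K
  have hx0' : algebraMap R K x ≠ 0 := fun h => hx0 (hinj (h.trans (map_zero _).symm))
  have hxinv : (algebraMap R K x)⁻¹ ∉ (LocalSubring.ofPrime _ P).toSubring := by
    intro h
    have hu : IsUnit (Subring.inclusion hle ⟨algebraMap R K x, x, rfl⟩) :=
      IsUnit.of_mul_eq_one ⟨_, h⟩ (Subtype.ext (mul_inv_cancel₀ hx0'))
    obtain ⟨⟨_, f, rfl⟩, hf⟩ := (hloc.map_nonunit _ hu).exists_right_inv
    have h1 : algebraMap R K x * algebraMap R K f = 1 := congrArg Subtype.val hf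
    rw [← map_mul, ← map_one (algebraMap R K)] at h1
    exact (mem_maximalIdeal x).mp hx (IsUnit.of_mul_eq_one _ (hinj h1))
  -- Otherwise x/x² = 1/x would lie in the chart, contradicting domination.
  have hx2 : x ∉ maximalIdeal R ^ 2 := by
    intro h
    refine hxinv (LocalSubring.le_ofPrime _ P ?_)
    have h1 := div_pow_mem_blowupChart (K := K) (a := x) h
    rwa [pow_two, div_mul_cancel_left₀ hx0'] at h1
  have hxP : chartHom R K (maximalIdeal R) x x ∈ P := by
    by_contra h
    exact hxinv (LocalSubring.mem_ofPrime_iff.mpr ⟨1, _, h, by simp⟩)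
  exact ⟨x, hx, hx2, P, hP, hxP, rfl, (transform_ne_top_iff hx hx2 hxP hI hI' hN).mp htop⟩

end Transform

end QuadTransform

/-! ### Isolated points of fibres -/

section Isolated

/-- The complement of q is the union of the closed sets of the finitely many other minimal primes.
-/
theorem PrimeSpectrum.isOpen_singleton_of_minimal_of_maximal {T : Type*} [CommRing T]
    [IsNoetherianRing T] (q : PrimeSpectrum T) (hmin : ∀ p, p ≤ q → p = q)
    (hmax : ∀ p, q ≤ p → p = q) : IsOpen {q} := by
  have hfin := (minimalPrimes.finite_of_isNoetherianRing T).subset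
    (Set.sdiff_subset (t := {q.asIdeal}))
  have h : ({q} : Set (PrimeSpectrum T))ᶜ =
      ⋃ I ∈ minimalPrimes T \ {q.asIdeal}, PrimeSpectrum.zeroLocus (I : Set T) := by
    ext p
    simp only [Set.mem_compl_iff, Set.mem_singleton_iff, Set.mem_iUnion, exists_prop,
      PrimeSpectrum.mem_zeroLocus, SetLike.coe_subset_coe]
    constructor
    · intro hp
      obtain ⟨I, hI, hle⟩ := Ideal.exists_minimalPrimes_le (J := p.asIdeal)
        (bot_le : (⊥ : Ideal T) ≤ _)
      exact ⟨I, ⟨hI, fun h => hp (hmax p (show q.asIdeal ≤ p.asIdeal from (Set.mem_singleton_iff.mp h) ▸ hle))⟩, hle⟩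
    · rintro ⟨I, ⟨hI, hne⟩, hle⟩ rfl
      exact hne (congrArg PrimeSpectrum.asIdeal (hmin ⟨I, hI.1.1⟩ hle))
  rw [← isClosed_compl_iff, h]
  exact hfin.isClosed_biUnion fun I _ => PrimeSpectrum.isClosed_zeroLocus _

/-- A criterion for Zariski's main theorem: if all primes in the fibre of `q` that are contained in
`q` are maximal, then `q` is isolated in its fibre. -/
theorem Algebra.ZariskisMainProperty.of_forall_isMaximal {A E : Type*} [CommRing A] [CommRing E]
    [Algebra A E] [Algebra.FiniteType A E] (q : Ideal E) [q.IsPrime]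
    (h : ∀ p : Ideal E, p.IsPrime → p ≤ q →
      p.comap (algebraMap A E) = q.comap (algebraMap A E) → p.IsMaximal) :
    Algebra.ZariskisMainProperty A q := by
  let x : PrimeSpectrum E := ⟨q, ‹_›⟩
  have hq : q.IsMaximal := h q ‹_› le_rfl rfl
  suffices hopen : IsOpen (X := PrimeSpectrum.comap (algebraMap A E) ⁻¹'
      {x.comap (algebraMap A E)}) {⟨x, rfl⟩} by
    have : Algebra.QuasiFiniteAt A q := Algebra.QuasiFiniteAt.of_isOpen_singleton_fiber x hopen
    exact .of_finiteType q
  let p := x.comap (algebraMap A E)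
  let e := PrimeSpectrum.preimageHomeomorphFiber A E p
  have hnoeth : IsNoetherianRing (p.asIdeal.Fiber E) :=
    Algebra.FiniteType.isNoetherianRing p.asIdeal.ResidueField _
  have hspec : ∀ z w : PrimeSpectrum (p.asIdeal.Fiber E), z ≤ w → (e.symm z).1 ≤ (e.symm w).1 := by
    intro z w hzw
    rw [PrimeSpectrum.le_iff_specializes] at hzw ⊢
    exact (hzw.map e.symm.continuous).map continuous_subtype_val
  -- In the fibre ring q is minimal, since primes below it are maximal by `h`, and maximal, since q
  -- is maximal in E.
  have hopen : IsOpen {e ⟨x, rfl⟩} := by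
    refine PrimeSpectrum.isOpen_singleton_of_minimal_of_maximal _ (fun z hz => ?_) fun z hz => ?_
    · have h1 := hspec _ _ hz
      rw [e.symm_apply_apply] at h1
      have h2 : (e.symm z).1.asIdeal.IsMaximal := h _ (e.symm z).1.2 h1
        (congrArg PrimeSpectrum.asIdeal (e.symm z).2)
      rw [← e.symm_apply_eq]
      exact Subtype.ext (PrimeSpectrum.ext (h2.eq_of_le hq.ne_top h1))
    · have h1 := hspec _ _ hz
      rw [e.symm_apply_apply] at h1
      rw [← e.symm_apply_eq]
      exact Subtype.ext (PrimeSpectrum.ext (hq.eq_of_le (e.symm z).1.2.ne_top h1).symm)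
  have h1 := e.isOpen_preimage.mpr hopen
  convert h1 using 1
  ext z
  simp

/-- A finite type algebra over a field with finite spectrum is quasi-finite, hence a finite module.
-/
theorem RingHom.isIntegral_of_finite_primeSpectrum {k T : Type*} [Field k] [CommRing T] (f : k →+* T)
    (hf : f.FiniteType) [_root_.Finite (PrimeSpectrum T)] : f.IsIntegral := by
  let _ := f.toAlgebra
  have : Algebra.FiniteType k T := hf
  have : Algebra.QuasiFinite k T :=
    Algebra.QuasiFinite.iff_finite_comap_preimage_singleton.mpr fun _ => Set.toFinite _
  have : Module.Finite k T := .of_quasiFinite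
  exact algebraMap_isIntegral_iff.mpr inferInstance

end Isolated

namespace QuadTransform

/-! ### Residue extensions at the base points. -/

section Integral

universe u v

variable {R : Type u} {K : Type v} [CommRing R] [IsRegularLocalRing R] [Field K] [Algebra R K]
  [FaithfulSMul R K] {y : R}

theorem finiteType_chartHom (hy : y ∈ maximalIdeal R) (hy2 : y ∉ maximalIdeal R ^ 2) :
    (chartHom R K (maximalIdeal R) y).FiniteType := by
  have hy0 : algebraMap R K y ≠ 0 := algebraMap_ne_zero_of_notMem_sq hy2
  obtain ⟨d, x, hx, rfl, hd⟩ := IsRegularLocalRing.exists_generators hy hy2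
  have e : chartHom R K (maximalIdeal R) (x 0) = (chartPresentation x hx).comp MvPolynomial.C := by
    ext r
    simp [coe_chartPresentation]
  rw [e]
  refine RingHom.FiniteType.comp (.of_surjective _ (chartPresentation_surjective x hx hy0)) ?_
  rw [← MvPolynomial.algebraMap_eq, RingHom.finiteType_algebraMap]
  infer_instance

theorem ofPrime_injective {K : Type*} [Field K] {D : Subring K} {P Q : Ideal D} [P.IsPrime]
    [Q.IsPrime] (h : LocalSubring.ofPrime D P = LocalSubring.ofPrime D Q) : P ≤ Q := by
  intro z hz
  by_contra hzQ
  have h1 : (z : K)⁻¹ ∈ (LocalSubring.ofPrime D P).toSubring := by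
    rw [h]
    exact LocalSubring.mem_ofPrime_iff.mpr ⟨1, z, hzQ, by simp⟩
  have hz0 : (z : K) ≠ 0 := fun h0 => hzQ (by
    rw [show z = 0 from Subtype.ext h0]; exact zero_mem _)
  refine (mem_maximalIdeal _).mp ((IsLocalization.AtPrime.to_map_mem_maximal_iff
    (LocalSubring.ofPrime D P).toSubring P z).mpr hz) ?_
  exact IsUnit.of_mul_eq_one ⟨_, h1⟩ (Subtype.ext (mul_inv_cancel₀ hz0))

/-- If an ideal has only finitely many base points in the first neighborhood, then the residue field
extensions at the base points are algebraic. -/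
theorem isIntegral_residue_of_finite_firstBasePoints {I : Ideal R} {r N : ℕ}
    (hfin : (firstBasePoints K I).Finite) (hy : y ∈ maximalIdeal R) (hy2 : y ∉ maximalIdeal R ^ 2)
    (hI : I ≤ maximalIdeal R ^ r) (hI' : ¬ I ≤ maximalIdeal R ^ (r + 1))
    (hN : maximalIdeal R ^ N ≤ I) (Q : Ideal (blowupChart R K (maximalIdeal R) y))
    (hQ : chartHom R K (maximalIdeal R) y y ∈ Q)
    (h : ∀ z : blowupChart R K (maximalIdeal R) y, (∃ b ∈ I,
        (z : K) = algebraMap R K b / algebraMap R K y ^ r) → z ∈ Q) :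
    ((Ideal.Quotient.mk Q).comp (chartHom R K (maximalIdeal R) y)).IsIntegral := by
  have hy0 : algebraMap R K y ≠ 0 := algebraMap_ne_zero_of_notMem_sq hy2
  set f := (Ideal.Quotient.mk Q).comp (chartHom R K (maximalIdeal R) y) with hf
  -- In the chart 𝔪 generates (y) ⊆ Q, so D/Q is an algebra over the residue field.
  have hker : ∀ a ∈ maximalIdeal R, f a = 0 := by
    intro a ha
    rw [hf, RingHom.comp_apply, Ideal.Quotient.eq_zero_iff_mem]
    have e : chartHom R K (maximalIdeal R) y a = chartHom R K (maximalIdeal R) y y *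
        ⟨_, div_mem_blowupChart ha⟩ := Subtype.ext (mul_div_cancel₀ _ hy0).symm
    rw [e]
    exact Ideal.mul_mem_right _ _ hQ
  let g : ResidueField R →+* _ := Ideal.Quotient.lift (maximalIdeal R) f hker
  have hg : g.comp (residue R) = f := RingHom.ext fun a =>
    Ideal.Quotient.lift_mk (maximalIdeal R) f hker
  have hft : g.FiniteType := by
    refine RingHom.FiniteType.of_comp_finiteType (f := residue R) ?_
    rw [hg]
    exact (finiteType_chartHom hy hy2).comp_surjective Ideal.Quotient.mk_surjective
  have hmem : ∀ p : PrimeSpectrum (blowupChart R K (maximalIdeal R) y ⧸ Q),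
      LocalSubring.ofPrime _ (p.asIdeal.comap (Ideal.Quotient.mk Q)) ∈ firstBasePoints K I := by
    intro p
    have hle : Q ≤ p.asIdeal.comap (Ideal.Quotient.mk Q) := fun z hz => by
      rw [Ideal.mem_comap, Ideal.Quotient.eq_zero_iff_mem.mpr hz]
      exact zero_mem _
    exact ofPrime_mem_firstBasePoints hy hy2 (hle hQ) hI hI' hN fun z hz => hle (h z hz)
  -- Every prime above Q is a base point, and distinct primes have distinct local rings.
  have : Finite (PrimeSpectrum (blowupChart R K (maximalIdeal R) y ⧸ Q)) := by
    have := hfin.to_subtype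
    refine Finite.of_injective (fun p => (⟨_, hmem p⟩ : firstBasePoints K I)) fun p p' hpp => ?_
    have h1 := congrArg Subtype.val hpp
    exact PrimeSpectrum.ext (Ideal.comap_injective_of_surjective _ Ideal.Quotient.mk_surjective
      (le_antisymm (ofPrime_injective h1) (ofPrime_injective h1.symm)))
  rw [← hg]
  exact (RingHom.isIntegral_of_surjective _ residue_surjective).trans _ _
    (g.isIntegral_of_finite_primeSpectrum hft)

end Integral

/-! ### Comparison of charts by Zariski's main theorem -/

section Comparison

/-- Quotients b/a with b in a finite generating set of J suffice. This supplies the finite type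
hypothesis of Zariski's main theorem. -/
theorem exists_finset_blowupChart_le {A K : Type*} [CommRing A] [IsNoetherianRing A] [Field K]
    [Algebra A K] (J : Ideal A) (a : A) :
    ∃ s : Finset K, (∀ z ∈ s, z ∈ blowupChart A K J a) ∧
      ∀ C : Subring K, (∀ r, algebraMap A K r ∈ C) → (∀ z ∈ s, z ∈ C) →
        blowupChart A K J a ≤ C := by
  classical
  obtain ⟨t, rfl⟩ := J.fg_of_isNoetherianRing
  refine ⟨t.image fun b => algebraMap A K b / algebraMap A K a, ?_, ?_⟩
  · intro z hz
    obtain ⟨b, hb, rfl⟩ := Finset.mem_image.mp hz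
    exact div_mem_blowupChart (Ideal.subset_span hb)
  · intro C hC hs
    refine blowupChart_le hC fun b hb => ?_
    induction hb using Submodule.span_induction with
    | mem b hb => exact hs _ (Finset.mem_image_of_mem _ hb)
    | zero => rw [map_zero, zero_div]; exact zero_mem _
    | add b c _ _ hb hc => rw [map_add, add_div]; exact add_mem hb hc
    | smul r b _ hb =>
      rw [smul_eq_mul, map_mul, mul_div_assoc]
      exact mul_mem (hC r) hb

variable {K : Type*} [Field K]

/-- If a discrete valuation ring `V` has no proper saturated subrings containing `T`, then `V` can
be separated from other valuation rings by elements that are integral over `T`. -/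
theorem exists_isIntegral_valuation_eq_one {V W : ValuationSubring K} [IsDiscreteValuationRing V]
    (hVW : V ≠ W) (hW : W ≠ ⊤) {T : Subring K} (hT : T ≤ V.toSubring)
    (hmin : ∀ C, IsSaturatedIn V C → T ≤ C → C = V.toSubring) :
    ∃ b : K, IsIntegral T b ∧ V.valuation b = 1 ∧ (T ≤ W.toSubring → W.valuation b < 1) := by
  by_contra! h
  have hTW : T ≤ W.toSubring := (h 1 isIntegral_one (map_one _)).1
  let B := (integralClosure T K).toSubring
  have hB : ∀ {V' : ValuationSubring K}, T ≤ V'.toSubring → B ≤ V'.toSubring := fun hV' z hz =>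
    mem_valuationSubring_of_isIntegral _ (isIntegral_mono hV' (show IsIntegral T z from hz))
  have hBint : ∀ z : K, IsIntegral B z → z ∈ B := fun z hz =>
    isIntegral_trans (R := T) z (show IsIntegral (integralClosure T K) z from hz)
  have hTB : T ≤ B := fun z hz => (integralClosure T K).algebraMap_mem ⟨z, hz⟩
  -- By minimality, elements of V are fractions with denominators t integral over T and V(t) = 1. If
  -- all these have W(t) ≥ 1, then V ⊆ W, so V = W.
  have hCV := hmin _ (isSaturatedIn_ofPrime_center (hB hT) hBint)
    (hTB.trans (LocalSubring.le_ofPrime _ _))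
  refine hVW (eq_of_le_of_isDiscreteValuationRing (fun z hz => ?_) hW)
  have hz' : z ∈ V.toSubring := hz
  rw [← hCV] at hz'
  obtain ⟨s, t, ht, rfl⟩ := LocalSubring.mem_ofPrime_iff.mp hz'
  have ht1 := (h t t.2 (notMem_center_iff.mp ht)).2
  have hs : W.valuation (s : K) ≤ 1 := (W.valuation_le_one_iff _).mpr (hB hTW s.2)
  have ht0 : (t : K) ≠ 0 := fun h0 => by
    rw [h0, map_zero] at ht1
    exact absurd ht1 (not_le.mpr zero_lt_one)
  exact (div_mem_iff_valuation_le ht0).mpr (hs.trans ht1)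

/-- Images of an algebra generated by a subring and an element that is integral over it. -/
theorem isIntegral_of_mem_adjoin {A D : Subring K} {b : K} {s : Set K} (hs : s ⊆ D)
    (hb : IsIntegral ↥(A ⊔ D) b) {E : Subalgebra A K} (hE : E = Algebra.adjoin A (insert b s))
    (hD : D ≤ E.toSubring) {T : Type*} [CommRing T] [Algebra A T] (φ : E →ₐ[A] T)
    (h : ∀ z : E, (z : K) ∈ D → IsIntegral A (φ z)) (z : E) : IsIntegral A (φ z) := by
  let F : Subalgebra A E := (integralClosure A T).comap φ
  have hADE : A ⊔ D ≤ E.toSubring := sup_le (fun z hz => E.algebraMap_mem ⟨z, hz⟩) hD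
  have hADF : A ⊔ D ≤ (F.map E.val).toSubring :=
    sup_le (fun z hz => (F.map E.val).algebraMap_mem ⟨z, hz⟩)
      fun z hz => ⟨⟨z, hD hz⟩, h ⟨z, hD hz⟩ hz, rfl⟩
  have hbE : b ∈ E := hE ▸ Algebra.subset_adjoin (Set.mem_insert _ _)
  have hbF : IsIntegral A (φ ⟨b, hbE⟩) := by
    let i : ↥(A ⊔ D) →+* E := Subring.inclusion hADE
    -- The image of A ⊔ D is integral over A, so the equation of b can be transported to
    -- coefficients in the integral closure.
    let g : ↥(A ⊔ D) →+* integralClosure A T :=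
      ((φ : E →+* T).comp i).codRestrict (integralClosure A T) fun z => by
        obtain ⟨w, hw, hwz⟩ := hADF z.2
        have e : i z = w := Subtype.ext hwz.symm
        rw [RingHom.comp_apply, e]
        exact hw
    obtain ⟨p, hp, hpb⟩ := hb
    have h1 : IsIntegral (integralClosure A T) (φ ⟨b, hbE⟩) := by
      refine ⟨p.map g, hp.map g, ?_⟩
      rw [Polynomial.eval₂_map]
      have e : (algebraMap (integralClosure A T) T).comp g = (φ : E →+* T).comp i := rfl
      have h2 : p.eval₂ i (⟨b, hbE⟩ : E) = 0 :=
        Subtype.ext ((Polynomial.hom_eval₂ p i (E.val : E →+* K) ⟨b, hbE⟩).trans hpb)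
      rw [e]
      exact (Polynomial.hom_eval₂ p i (φ : E →+* T) ⟨b, hbE⟩).symm.trans
        ((congrArg _ h2).trans (map_zero _))
    exact isIntegral_trans (R := A) _ h1
  have hEF : Algebra.adjoin A (insert b s) ≤ F.map E.val := by
    refine Algebra.adjoin_le ?_
    rintro z (rfl | hz)
    · exact ⟨⟨z, hbE⟩, hbF, rfl⟩
    · exact hADF (le_sup_right (a := A) (hs hz))
  obtain ⟨w, hw, hwz⟩ := hEF (show (z : K) ∈ _ from hE.le z.2)
  have e : w = z := Subtype.ext hwz
  exact e ▸ hw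

/-- A form of Zariski's main theorem for a saturated subring of a valuation ring. -/
theorem le_of_forall_isIntegral_quotient {V : ValuationSubring K} {A D : Subring K}
    (hA : IsSaturatedIn V A) (hD : D ≤ V.toSubring) {s : Finset K} (hsD : ∀ z ∈ s, z ∈ D)
    (hgen : ∀ C : Subring K, A ≤ C → (∀ z ∈ s, z ∈ C) → D ≤ C) {b : K}
    (hb : IsIntegral ↥(A ⊔ D) b) {E : Subalgebra A K}
    (hE : E = Algebra.adjoin A (insert b (s : Set K)))
    (h : ∀ q : Ideal E, q.IsPrime → (∀ z ∈ q, V.valuation (z : K) < 1) →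
      (∀ z : E, (z : K) ∈ A → V.valuation (z : K) < 1 → z ∈ q) →
      ∀ z : E, (z : K) ∈ D → IsIntegral A (Ideal.Quotient.mk q z)) : D ≤ A := by
  classical
  have hbV : b ∈ V :=
    mem_valuationSubring_of_isIntegral V (isIntegral_mono (sup_le hA.le hD) hb)
  have hEV : E.toSubring ≤ V.toSubring := by
    intro z hz
    replace hz : z ∈ Algebra.adjoin A (insert b (s : Set K)) := hE ▸ hz
    induction hz using Algebra.adjoin_induction with
    | mem z hz =>
      rcases hz with rfl | hz
      · exact hbV
      · exact hD (hsD z hz)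
    | algebraMap r => exact hA.le r.2
    | add x y _ _ hx hy => exact add_mem hx hy
    | mul x y _ _ hx hy => exact mul_mem hx hy
  have hDE : D ≤ E.toSubring := hgen _ (fun z hz => E.algebraMap_mem ⟨z, hz⟩)
    fun z hz => hE ▸ Algebra.subset_adjoin (Set.mem_insert_of_mem _ hz)
  have hft : Algebra.FiniteType A E :=
    E.fg_iff_finiteType.mp ⟨insert b s, by rw [Finset.coe_insert, hE]⟩
  let q : Ideal E := center V E.toSubring hEV
  have hq : q.IsPrime := inferInstanceAs (center V E.toSubring hEV).IsPrime
  have hmax : (q.comap (algebraMap A E)).IsMaximal := by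
    have hmem : ∀ t : A, t ∈ q.comap (algebraMap A E) ↔ V.valuation (t : K) < 1 := fun t =>
      mem_center_iff (h := hEV) (b := algebraMap A E t)
    refine Ideal.isMaximal_iff.mpr ⟨fun h1 => ?_, fun J x hJ hx hxJ => ?_⟩
    · have := (hmem 1).mp h1
      simp at this
    · have hx1 : V.valuation (x : K) = 1 := le_antisymm ((V.valuation_le_one_iff _).mpr
        (hA.le x.2)) (not_lt.mp fun h => hx ((hmem x).mpr h))
      have hinv : (x : K)⁻¹ ∈ A := hA.inv_mem _ x.2
        ((V.valuation_le_one_iff _).mp (by rw [map_inv₀, hx1, inv_one]))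
      have hx0 : (x : K) ≠ 0 := fun h0 => by simp [h0] at hx1
      have e : (1 : A) = ⟨_, hinv⟩ * x := Subtype.ext (inv_mul_cancel₀ hx0).symm
      rw [e]
      exact J.mul_mem_left _ hxJ
  have hzmt : Algebra.ZariskisMainProperty A q := by
    refine .of_forall_isMaximal q fun p hp hpq hcomap => ?_
    -- Integrality of E/p over A, with a maximal contraction to A, makes p maximal.
    have hint : Algebra.IsIntegral A (E ⧸ p) := by
      refine ⟨fun z => ?_⟩
      obtain ⟨z, rfl⟩ := Ideal.Quotient.mk_surjective z
      refine isIntegral_of_mem_adjoin (fun z hz => hsD z hz) hb hE hDE (Ideal.Quotient.mkₐ A p)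
        (h p hp (fun z hz => mem_center_iff.mp (hpq hz)) fun z hzA hz => ?_) z
      have h1 : (⟨z, hzA⟩ : A) ∈ p.comap (algebraMap A E) := by
        rw [hcomap]
        exact (mem_center_iff (h := hEV)).mpr hz
      exact h1
    have hbot : ((⊥ : Ideal (E ⧸ p)).comap (algebraMap A (E ⧸ p))).IsMaximal := by
      have e : (⊥ : Ideal (E ⧸ p)).comap (algebraMap A (E ⧸ p)) = p.comap (algebraMap A E) := by
        ext t
        rw [Ideal.mem_comap, Ideal.mem_bot, Ideal.mem_comap, ← Ideal.Quotient.eq_zero_iff_mem]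
        rfl
      rw [e, hcomap]
      exact hmax
    exact Ideal.Quotient.maximal_of_isField _
      (Ring.isField_iff_maximal_bot.mpr
        (Ideal.isMaximal_of_isIntegral_of_isMaximal_comap _ hbot))
  -- Both f and f^m z are integral over A, so they lie in A; f is a unit of V, so saturation inverts
  -- it in A and yields z ∈ A.
  obtain ⟨f, hfq, hf, hfx⟩ := Algebra.zariskisMainProperty_iff.mp hzmt
  have hmemA : ∀ z : E, IsIntegral A z → (z : K) ∈ A := fun z hz =>
    hA.integral_mem _ (hz.map E.val)
  have hf1 : V.valuation (f : K) = 1 := notMem_center_iff.mp hfq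
  have hf0 : (f : K) ≠ 0 := fun h0 => by simp [h0] at hf1
  have hinv : (f : K)⁻¹ ∈ A := hA.inv_mem _ (hmemA f hf)
    ((V.valuation_le_one_iff _).mp (by rw [map_inv₀, hf1, inv_one]))
  intro z hz
  obtain ⟨m, hm⟩ := hfx ⟨z, hDE hz⟩
  have h1 : (f : K) ^ m * z ∈ A := hmemA _ hm
  have e : z = (f : K)⁻¹ ^ m * ((f : K) ^ m * z) := by
    rw [← mul_assoc, ← mul_pow, inv_mul_cancel₀ hf0, one_pow, one_mul]
  rw [e]
  exact mul_mem (pow_mem hinv m) h1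

end Comparison

/-! ### Comparison of the blow-ups of 𝔪 and I at the center of V. -/

section Core

universe u v

variable {R : Type u} {K : Type v} [CommRing R] [IsRegularLocalRing R] [Field K] [Algebra R K]
  {y : R}

theorem mem_ofPrime_of_isIntegral [IsFractionRing R K] (hy : y ∈ maximalIdeal R)
    (hy2 : y ∉ maximalIdeal R ^ 2) (Q : Ideal (blowupChart R K (maximalIdeal R) y)) [Q.IsPrime]
    (hQ : chartHom R K (maximalIdeal R) y y ∈ Q) {z : K}
    (hz : IsIntegral (LocalSubring.ofPrime _ Q).toSubring z) :
    z ∈ (LocalSubring.ofPrime _ Q).toSubring := by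
  have := isIntegrallyClosed_ofPrime_chart hy hy2 Q hQ
  have : IsFractionRing (LocalSubring.ofPrime _ Q).toSubring K := by
    refine IsFractionRing.of_field _ _ fun z => ?_
    obtain ⟨f, g, -, rfl⟩ := IsFractionRing.div_surjective (A := R) z
    exact ⟨⟨_, LocalSubring.le_ofPrime _ Q (algebraMap_mem_blowupChart f)⟩,
      ⟨_, LocalSubring.le_ofPrime _ Q (algebraMap_mem_blowupChart g)⟩, rfl⟩
  obtain ⟨w, rfl⟩ := IsIntegrallyClosed.isIntegral_iff.mp hz
  exact w.2

theorem ofPrime_le_ofPrime_span {P Q : Ideal (blowupChart R K (maximalIdeal R) y)} [P.IsPrime]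
    [Q.IsPrime] (hP : P = Ideal.span {chartHom R K (maximalIdeal R) y y})
    (hQ : chartHom R K (maximalIdeal R) y y ∈ Q) :
    (LocalSubring.ofPrime _ Q).toSubring ≤ (LocalSubring.ofPrime _ P).toSubring := by
  intro x hx
  obtain ⟨f, t, ht, rfl⟩ := LocalSubring.mem_ofPrime_iff.mp hx
  exact LocalSubring.mem_ofPrime_iff.mpr
    ⟨f, t, fun h => ht ((Ideal.span_singleton_le_iff_mem Q).mpr hQ (hP ▸ h)), rfl⟩

variable {I : Ideal R} {r : ℕ}

/-- Let `V` have no proper saturated subrings that contain a chart of the blow-up of the maximal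
ideal and a chart of the blow-up of `I`. If the fibres over the points where the transform of `I` is
proper are algebraic, then the former chart is contained in the local ring of the center of `V` on
the latter. -/
theorem blowupChart_le_ofPrime_center [IsFractionRing R K] {V W : ValuationSubring K}
    [IsDiscreteValuationRing V] (hVW : V ≠ W) (hW : W ≠ ⊤) (hy : y ∈ maximalIdeal R)
    (hy2 : y ∉ maximalIdeal R ^ 2) {P : Ideal (blowupChart R K (maximalIdeal R) y)} [P.IsPrime]
    (hP : P = Ideal.span {chartHom R K (maximalIdeal R) y y})
    (hWP : W.toSubring = (LocalSubring.ofPrime _ P).toSubring) (hI : I ≤ maximalIdeal R ^ r)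
    {a : R} (haI : a ∈ I) (ha : algebraMap R K a ≠ 0)
    (hB : normalizedBlowupChart R K I a ≤ V.toSubring)
    (hD : blowupChart R K (maximalIdeal R) y ≤ V.toSubring)
    (hyV : V.valuation (algebraMap R K y) < 1)
    (hmin : ∀ C, IsSaturatedIn V C → blowupChart R K (maximalIdeal R) y ≤ C →
      blowupChart R K I a ≤ C → C = V.toSubring)
    (hint : ∀ Q : Ideal (blowupChart R K (maximalIdeal R) y), Q.IsPrime →
      chartHom R K (maximalIdeal R) y y ∈ Q →
      (∀ z : blowupChart R K (maximalIdeal R) y, (∃ b ∈ I,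
        (z : K) = algebraMap R K b / algebraMap R K y ^ r) → z ∈ Q) →
      ((Ideal.Quotient.mk Q).comp (chartHom R K (maximalIdeal R) y)).IsIntegral) :
    blowupChart R K (maximalIdeal R) y ≤
      (LocalSubring.ofPrime _ (center V (normalizedBlowupChart R K I a) hB)).toSubring := by
  classical
  have hy0 : algebraMap R K y ≠ 0 := algebraMap_ne_zero_of_notMem_sq hy2
  have hQW : ∀ (Q : Ideal (blowupChart R K (maximalIdeal R) y)) [Q.IsPrime],
      chartHom R K (maximalIdeal R) y y ∈ Q →
      (LocalSubring.ofPrime _ Q).toSubring ≤ W.toSubring := fun Q _ hQ =>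
    hWP ▸ ofPrime_le_ofPrime_span hP hQ
  -- The center of W on D is (y), which lies in every Q containing y.
  have hWQ : ∀ d : blowupChart R K (maximalIdeal R) y, W.valuation (d : K) < 1 →
      ∀ Q : Ideal (blowupChart R K (maximalIdeal R) y),
        chartHom R K (maximalIdeal R) y y ∈ Q → d ∈ Q := by
    intro d hd Q hQ
    suffices hdP : d ∈ P from (Ideal.span_singleton_le_iff_mem Q).mpr hQ (hP ▸ hdP)
    by_contra hdP
    have h1 : (d : K)⁻¹ ∈ W.toSubring := by
      rw [hWP]
      exact LocalSubring.mem_ofPrime_iff.mpr ⟨1, d, hdP, by simp⟩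
    have hd0 : (d : K) ≠ 0 := fun h0 => hdP (by
      rw [show d = 0 from Subtype.ext h0]; exact zero_mem _)
    have h2 := (W.valuation_le_one_iff _).mpr (show (d : K)⁻¹ ∈ W from h1)
    rw [map_inv₀] at h2
    exact absurd ((inv_le_one₀ (zero_lt_iff.mpr (W.valuation.ne_zero_iff.mpr hd0))).mp h2)
      (not_le.mpr hd)
  clear hWP hP
  set D := blowupChart R K (maximalIdeal R) y with hDdef
  set A := (LocalSubring.ofPrime _ (center V (normalizedBlowupChart R K I a) hB)).toSubring
    with hAdef
  have hA : IsSaturatedIn V A :=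
    isSaturatedIn_ofPrime_center hB fun z hz => mem_normalizedBlowupChart_of_isIntegral hz
  have hchartA : blowupChart R K I a ≤ A :=
    (blowupChart_le_normalizedBlowupChart I a).trans (LocalSubring.le_ofPrime _ _)
  have hRA : ∀ f, algebraMap R K f ∈ A := fun f => hchartA (algebraMap_mem_blowupChart f)
  -- The element b is adjoined to keep the exceptional divisor away from the center of V.
  obtain ⟨b, hb, hb1, hbW⟩ := exists_isIntegral_valuation_eq_one hVW hW (sup_le hA.le hD)
    fun C hC hle => hmin C hC (le_sup_right.trans hle) (hchartA.trans (le_sup_left.trans hle))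
  obtain ⟨s, hsD, hs⟩ := exists_finset_blowupChart_le (K := K) (maximalIdeal R) y
  obtain ⟨E, hE⟩ : ∃ E, E = Algebra.adjoin A (insert b (s : Set K)) := ⟨_, rfl⟩
  have hDE : D ≤ E.toSubring := hs _ (fun f => E.algebraMap_mem ⟨_, hRA f⟩)
    fun z hz => hE ▸ Algebra.subset_adjoin (Set.mem_insert_of_mem _ hz)
  have hbE : b ∈ E := hE ▸ Algebra.subset_adjoin (Set.mem_insert _ _)
  refine le_of_forall_isIntegral_quotient hA hD hsD
    (fun C hAC hsC => hs C (fun f => hAC (hRA f)) hsC) hb hE fun q hq hqV hqA => ?_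
  let Q : Ideal D := q.comap (Subring.inclusion hDE : D →+* E)
  have hQmem : ∀ d : D, d ∈ Q ↔ (⟨d, hDE d.2⟩ : E) ∈ q := fun d => Iff.rfl
  have hQ : Q.IsPrime := inferInstanceAs (q.comap (Subring.inclusion hDE : D →+* E)).IsPrime
  have hyQ : chartHom R K (maximalIdeal R) y y ∈ Q := hqA _ (hRA y) hyV
  by_cases hbase : ∀ z : D, (∃ b ∈ I, (z : K) = algebraMap R K b / algebraMap R K y ^ r) → z ∈ Q
  · intro z hz
    -- A monic equation over R in D/Q maps to one in E/q with coefficients in A.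
    obtain ⟨p, hp, hpz⟩ := hint Q hQ hyQ hbase (Ideal.Quotient.mk Q ⟨z, hz⟩)
    let ρ : R →+* A := (algebraMap R K).codRestrict A hRA
    refine ⟨p.map ρ, hp.map ρ, ?_⟩
    rw [Polynomial.eval₂_map]
    rw [← Polynomial.hom_eval₂, Ideal.Quotient.eq_zero_iff_mem, hQmem] at hpz
    have e : (⟨_, hDE (p.eval₂ (chartHom R K (maximalIdeal R) y) ⟨z, hz⟩).2⟩ : E) =
        p.eval₂ ((algebraMap A E).comp ρ) z :=
      Polynomial.hom_eval₂ p (chartHom R K (maximalIdeal R) y) (Subring.inclusion hDE : D →+* E) _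
    rw [e, ← Ideal.Quotient.eq_zero_iff_mem, Polynomial.hom_eval₂] at hpz
    exact hpz
  · exfalso
    push Not at hbase
    obtain ⟨z, ⟨c, hc, hzc⟩, hzQ⟩ := hbase
    set S := (LocalSubring.ofPrime D Q).toSubring with hS
    have hDS : D ≤ S := LocalSubring.le_ofPrime _ Q
    have hinvS : ∀ d : D, d ∉ Q → (d : K)⁻¹ ∈ S := fun d hd =>
      LocalSubring.mem_ofPrime_iff.mpr ⟨1, d, hd, by simp⟩
    let u : D := ⟨algebraMap R K a / algebraMap R K y ^ r, div_pow_mem_blowupChart (hI haI)⟩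
    -- Since c/y^r = (c/a) u with c/a ∈ A, membership of u in q would force that of c/y^r. So a
    -- generates I at Q up to the factor y^r.
    have huQ : u ∉ Q := by
      intro hu
      have e : (⟨z, hDE z.2⟩ : E) =
          algebraMap A E ⟨_, hchartA (div_mem_blowupChart hc)⟩ * ⟨u, hDE u.2⟩ := by
        apply Subtype.ext
        change (z : K) = algebraMap R K c / algebraMap R K a *
          (algebraMap R K a / algebraMap R K y ^ r)
        rw [hzc]
        field_simp
      refine hzQ ((hQmem z).mpr ?_)
      rw [e]
      exact q.mul_mem_left _ ((hQmem u).mp hu)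
    have hSint : ∀ x : K, IsIntegral S x → x ∈ S := fun x hx =>
      mem_ofPrime_of_isIntegral hy hy2 Q hyQ hx
    have hBS : normalizedBlowupChart R K I a ≤ S := by
      refine normalizedBlowupChart_le hSint (blowupChart_le
        (fun f => hDS (algebraMap_mem_blowupChart f)) fun f hf => ?_)
      have e : algebraMap R K f / algebraMap R K a =
          algebraMap R K f / algebraMap R K y ^ r * (u : K)⁻¹ := by
        change _ = _ * (algebraMap R K a / algebraMap R K y ^ r)⁻¹
        field_simp
      rw [e]
      exact mul_mem (hDS (div_pow_mem_blowupChart (hI hf))) (hinvS u huQ)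
    -- A denominator t has V(t) = 1, so t ∉ q. Writing t = d/e in D_Q, primality of q gives d ∉ Q,
    -- so t is a unit of S.
    have hAS : A ≤ S := by
      intro x hx
      obtain ⟨f, t, ht, rfl⟩ := LocalSubring.mem_ofPrime_iff.mp hx
      have ht1 := notMem_center_iff.mp ht
      have htA : (t : K) ∈ A := LocalSubring.le_ofPrime _ _ t.2
      obtain ⟨d, e, he, hde⟩ := LocalSubring.mem_ofPrime_iff.mp (hBS t.2)
      have he0 : (e : K) ≠ 0 := fun h0 => he (by
        rw [show e = 0 from Subtype.ext h0]; exact zero_mem _)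
      have hd : d ∉ Q := by
        intro hd
        have h1 : (⟨d, hDE d.2⟩ : E) = algebraMap A E ⟨t, htA⟩ * ⟨e, hDE e.2⟩ :=
          Subtype.ext ((div_eq_iff he0).mp hde.symm)
        rw [hQmem, h1] at hd
        rcases hq.mem_or_mem hd with h2 | h2
        · exact absurd (hqV _ h2) (by
            change ¬ V.valuation (t : K) < 1
            rw [ht1]
            exact lt_irrefl _)
        · exact he h2
      rw [div_eq_mul_inv, hde, inv_div, div_eq_mul_inv]
      exact mul_mem (hBS f.2) (mul_mem (hDS e.2) (hinvS d hd))
    have hbS : b ∈ S := hSint _ (isIntegral_mono (sup_le hAS hDS) hb)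
    have hSW : S ≤ W.toSubring := hQW Q hyQ
    have hbW1 := hbW ((sup_le hAS hDS).trans hSW)
    obtain ⟨d, e, he, hde⟩ := LocalSubring.mem_ofPrime_iff.mp hbS
    have he0 : (e : K) ≠ 0 := fun h0 => he (by
      rw [show e = 0 from Subtype.ext h0]; exact zero_mem _)
    have hdbe : (d : K) = b * e := (div_eq_iff he0).mp hde.symm
    -- Normality puts b = d/e in S ⊆ W, and W(b) < 1 forces d ∈ (y) ⊆ Q. Then b or e lies in q,
    -- contradicting V(b) = 1 or e ∉ Q.
    have hdQ : d ∈ Q := by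
      refine hWQ d ?_ Q hyQ
      rw [hdbe, map_mul]
      exact mul_lt_one_of_lt_of_le hbW1 ((W.valuation_le_one_iff _).mpr (hSW (hDS e.2)))
    have h1 : (⟨d, hDE d.2⟩ : E) = ⟨b, hbE⟩ * ⟨e, hDE e.2⟩ := Subtype.ext hdbe
    rw [hQmem, h1] at hdQ
    rcases hq.mem_or_mem hdQ with h2 | h2
    · exact absurd (hqV _ h2) (by
        change ¬ V.valuation b < 1
        rw [hb1]
        exact lt_irrefl _)
    · exact he h2

end Core

/-! ### Rees valuation rings of products and transforms -/

section Products

universe u v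

theorem div_mul_mem_of_mem_mul {A K : Type*} [CommRing A] [Field K] [Algebra A K] {J₁ J₂ : Ideal A}
    {C : Subring K} {x a : A} (h₁ : ∀ b ∈ J₁, algebraMap A K b / algebraMap A K x ∈ C)
    (h₂ : ∀ b ∈ J₂, algebraMap A K b / algebraMap A K a ∈ C) :
    ∀ b ∈ J₁ * J₂, algebraMap A K b / algebraMap A K (x * a) ∈ C := by
  intro b hb
  induction hb using Submodule.mul_induction_on' with
  | mem_mul_mem b hb c hc =>
    rw [map_mul, map_mul, mul_div_mul_comm]
    exact mul_mem (h₁ b hb) (h₂ c hc)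
  | add b _ c _ hb hc => rw [map_add, add_div]; exact add_mem hb hc

theorem ne_top_of_isDiscreteValuationRing {K : Type*} [Field K] {V : ValuationSubring K}
    [IsDiscreteValuationRing V] : V ≠ ⊤ := by
  rintro rfl
  obtain ⟨ϖ, hϖ⟩ := IsDiscreteValuationRing.exists_irreducible (⊤ : ValuationSubring K)
  refine hϖ.not_isUnit (IsUnit.of_mul_eq_one ⟨(ϖ : K)⁻¹, trivial⟩ (Subtype.ext ?_))
  exact mul_inv_cancel₀ fun h0 => hϖ.ne_zero (Subtype.ext h0)

variable {R : Type u} {K : Type v} [CommRing R] [IsRegularLocalRing R] [Field K] [Algebra R K]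
  {y : R} {V W : ValuationSubring K}

/-- For y ∈ 𝔪² the chart would contain y/y² = 1/y. So a generator of 𝔪V has order one. -/
theorem notMem_sq_of_blowupChart_le (hy0 : algebraMap R K y ≠ 0)
    (hD : blowupChart R K (maximalIdeal R) y ≤ V.toSubring)
    (hlt : V.valuation (algebraMap R K y) < 1) : y ∉ maximalIdeal R ^ 2 := by
  intro h
  have h1 : algebraMap R K y / algebraMap R K y ^ 2 ∈ V := hD (div_pow_mem_blowupChart h)
  rw [pow_two, div_mul_cancel_left₀ hy0, ← V.valuation_le_one_iff, map_inv₀] at h1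
  exact absurd ((inv_le_one₀ (zero_lt_iff.mpr (V.valuation.ne_zero_iff.mpr hy0))).mp h1)
    (not_le.mpr hlt)

variable [IsFractionRing R K]

theorem isSaturatedIn_ofPrime_chart (hy : y ∈ maximalIdeal R) (hy2 : y ∉ maximalIdeal R ^ 2)
    (hD : blowupChart R K (maximalIdeal R) y ≤ V.toSubring)
    (hlt : V.valuation (algebraMap R K y) < 1) :
    IsSaturatedIn V (LocalSubring.ofPrime _ (center V _ hD)).toSubring :=
  isSaturatedIn_ofPrime_center_of_isIntegral hD fun _ hz =>
    mem_ofPrime_of_isIntegral hy hy2 _ (mem_center_iff.mpr hlt) hz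

variable [IsDomain R]

/-- The order function does not involve y, so uniqueness realizes the same W on the chart of every
element of order one. -/
theorem IsOrderValuationRing.exists_eq_ofPrime (hW : IsOrderValuationRing R K W)
    (hy : y ∈ maximalIdeal R) (hy2 : y ∉ maximalIdeal R ^ 2) :
    IsDiscreteValuationRing W ∧
      ∃ (P : Ideal (blowupChart R K (maximalIdeal R) y)) (_ : P.IsPrime),
        P = Ideal.span {chartHom R K (maximalIdeal R) y y} ∧
        W.toSubring = (LocalSubring.ofPrime _ P).toSubring := by
  obtain ⟨W', hW', h⟩ := exists_isOrderValuationRing (K := K) hy hy2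
  rwa [← hW.unique hW'] at h

/-- The local ring D_Q is contained in D_(y) = W, and a discrete valuation ring has no proper
overring except the field. -/
theorem IsOrderValuationRing.eq_of_ofPrime_center_eq [IsDiscreteValuationRing V]
    (hW : IsOrderValuationRing R K W) (hy : y ∈ maximalIdeal R) (hy2 : y ∉ maximalIdeal R ^ 2)
    (hD : blowupChart R K (maximalIdeal R) y ≤ V.toSubring)
    (hlt : V.valuation (algebraMap R K y) < 1)
    (h : (LocalSubring.ofPrime _ (center V _ hD)).toSubring = V.toSubring) : V = W := by
  obtain ⟨hdvr, P, hP, hPy, hWP⟩ := hW.exists_eq_ofPrime hy hy2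
  refine eq_of_le_of_isDiscreteValuationRing (fun z hz => ?_) ne_top_of_isDiscreteValuationRing
  change z ∈ W.toSubring
  rw [hWP]
  exact ofPrime_le_ofPrime_span hPy (mem_center_iff.mpr hlt) (h.ge hz)

/-- The order valuation ring is the only Rees valuation ring of the maximal ideal. -/
theorem IsOrderValuationRing.reesValuationRings_maximalIdeal (hW : IsOrderValuationRing R K W)
    (hy : y ∈ maximalIdeal R) (hy2 : y ∉ maximalIdeal R ^ 2) :
    reesValuationRings R K (maximalIdeal R) = {W} := by
  have hy0 : algebraMap R K y ≠ 0 := algebraMap_ne_zero_of_notMem_sq hy2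
  have hm : maximalIdeal R ≠ ⊥ := fun h => hy0 (by
    rw [h, Ideal.mem_bot] at hy
    rw [hy, map_zero])
  ext V
  rw [Set.mem_singleton_iff]
  constructor
  · intro hV
    have hA := algebraMap_mem_of_mem_reesValuationRings hV
    obtain ⟨x, hx, hx0, hmax⟩ := exists_forall_valuation_le hA hm
    have hx0' : algebraMap R K x ≠ 0 := fun h =>
      hx0 (FaithfulSMul.algebraMap_injective R K (h.trans (map_zero _).symm))
    have hlt := valuation_lt_one_of_mem_reesValuationRings hV hx
    have hD := blowupChart_le_valuationSubring hA hx0' hmax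
    have hx2 := notMem_sq_of_blowupChart_le hx0' hD hlt
    have hdvr := hV.1
    exact hW.eq_of_ofPrime_center_eq hx hx2 hD hlt (eq_of_mem_reesValuationRings hV hx hx0'
      (isSaturatedIn_ofPrime_chart hx hx2 hD hlt) (LocalSubring.le_ofPrime _ _))
  · rintro rfl
    obtain ⟨hdvr, P, hP, hPy, hVP⟩ := hW.exists_eq_ofPrime hy hy2
    have hD : blowupChart R K (maximalIdeal R) y ≤ V.toSubring :=
      hVP ▸ LocalSubring.le_ofPrime _ P
    refine mem_reesValuationRings_iff.mpr ⟨hdvr, y, hy, fun h => hy0 (h ▸ map_zero _), hD, ?_,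
      fun C hC hle => le_antisymm hC.le ?_⟩
    · by_contra h
      have h1 : (algebraMap R K y)⁻¹ ∈ V.toSubring := by
        refine (V.valuation_le_one_iff _).mp ?_
        rw [map_inv₀]
        exact inv_le_one_of_one_le₀ (not_lt.mp h)
      rw [hVP] at h1
      have hprime := prime_ofPrime_chart hy hy2 P (hPy ▸ Ideal.mem_span_singleton_self _)
        (w := ⟨_, LocalSubring.le_ofPrime _ P (algebraMap_mem_blowupChart y)⟩) rfl
      exact hprime.not_isUnit (IsUnit.of_mul_eq_one ⟨_, h1⟩ (Subtype.ext (mul_inv_cancel₀ hy0)))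
    · rw [hVP]
      exact hC.ofPrime_le hle hVP.ge

end Products

/-! ### From transforms at base points to the product 𝔪I. -/

section BasePoints

universe u v

variable {R : Type u} {K : Type v} [CommRing R] [IsRegularLocalRing R] [Field K] [Algebra R K]
  [FaithfulSMul R K] {y : R} {Q : Ideal (blowupChart R K (maximalIdeal R) y)} [Q.IsPrime]
  {I : Ideal R} {r N : ℕ}

theorem mem_transform_of_eq_div (hy : y ∈ maximalIdeal R) (hy2 : y ∉ maximalIdeal R ^ 2)
    (hQ : chartHom R K (maximalIdeal R) y y ∈ Q) (hI : I ≤ maximalIdeal R ^ r)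
    (hI' : ¬ I ≤ maximalIdeal R ^ (r + 1)) (hN : maximalIdeal R ^ N ≤ I)
    {s : (LocalSubring.ofPrime _ Q).toSubring} {b : R} (hb : b ∈ I)
    (hs : (s : K) = algebraMap R K b / algebraMap R K y ^ r) :
    s ∈ transform I (LocalSubring.ofPrime _ Q).toSubring := by
  have hy0 : algebraMap R K y ≠ 0 := algebraMap_ne_zero_of_notMem_sq hy2
  refine (mem_transform_iff hy hy2 hQ hI hI' hN
    (w := ⟨_, LocalSubring.le_ofPrime _ Q (algebraMap_mem_blowupChart y)⟩) rfl).mpr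
    (Ideal.subset_span ⟨b, hb, ?_⟩)
  rw [Subring.coe_mul, hs]
  exact div_mul_cancel₀ _ (pow_ne_zero r hy0)

/-- For t in the transform and s = a/y^r, the quotient t/s equals t y^r / a with t y^r ∈ IS. -/
theorem blowupChart_transform_le (hy : y ∈ maximalIdeal R) (hy2 : y ∉ maximalIdeal R ^ 2)
    (hQ : chartHom R K (maximalIdeal R) y y ∈ Q) (hI : I ≤ maximalIdeal R ^ r)
    (hI' : ¬ I ≤ maximalIdeal R ^ (r + 1)) (hN : maximalIdeal R ^ N ≤ I) {C : Subring K}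
    (hC : (LocalSubring.ofPrime _ Q).toSubring ≤ C) {a : R}
    (hIC : ∀ b ∈ I, algebraMap R K b / algebraMap R K a ∈ C)
    {s : (LocalSubring.ofPrime _ Q).toSubring}
    (hs : (s : K) = algebraMap R K a / algebraMap R K y ^ r) :
    blowupChart _ K (transform I (LocalSubring.ofPrime _ Q).toSubring) s ≤ C := by
  refine blowupChart_le (fun t => hC t.2) fun t ht => ?_
  have h := div_mem_of_mem_extension hC hIC ((mem_transform_iff hy hy2 hQ hI hI' hN
    (w := ⟨_, LocalSubring.le_ofPrime _ Q (algebraMap_mem_blowupChart y)⟩) rfl).mp ht)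
  have e : (t : K) / s = t * algebraMap R K y ^ r / algebraMap R K a := by
    rw [hs, div_div_eq_mul_div]
  exact e ▸ h

/-- Rees valuation rings of the transform of `I` in a base point are Rees valuation rings of the
product of `I` with the maximal ideal. -/
theorem mem_reesValuationRings_mul_of_mem_firstBasePoints [IsDomain R]
    (hI : I ≤ maximalIdeal R ^ r) (hI' : ¬ I ≤ maximalIdeal R ^ (r + 1))
    (hN : maximalIdeal R ^ N ≤ I) {S : LocalSubring K} (hS : S ∈ firstBasePoints K I)
    {V : ValuationSubring K} (hV : V ∈ reesValuationRings S.toSubring K (transform I S.toSubring)) :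
    V ∈ reesValuationRings R K (maximalIdeal R * I) := by
  obtain ⟨y, hy, hy2, Q, hQp, hQ, rfl, -⟩ := exists_of_mem_firstBasePoints hI hI' hN hS
  have hy0 : algebraMap R K y ≠ 0 := algebraMap_ne_zero_of_notMem_sq hy2
  have hSV : (LocalSubring.ofPrime _ Q).toSubring ≤ V.toSubring := fun z hz =>
    algebraMap_mem_of_mem_reesValuationRings hV ⟨z, hz⟩
  have hD := (LocalSubring.le_ofPrime _ Q).trans hSV
  have hA : ∀ f, algebraMap R K f ∈ V := fun f => hD (algebraMap_mem_blowupChart f)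
  have hI0 : I ≠ ⊥ := fun h => hI' (h ▸ bot_le)
  obtain ⟨a, haI, ha0, hmax⟩ := exists_forall_valuation_le hA hI0
  have ha : algebraMap R K a ≠ 0 := fun h =>
    ha0 (FaithfulSMul.algebraMap_injective R K (h.trans (map_zero _).symm))
  have hy0' : y ≠ 0 := fun h => hy0 (h ▸ map_zero _)
  let s : (LocalSubring.ofPrime _ Q).toSubring :=
    ⟨_, LocalSubring.le_ofPrime _ Q (div_pow_mem_blowupChart (hI haI))⟩
  have hsT := mem_transform_of_eq_div hy hy2 hQ hI hI' hN (s := s) haI rfl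
  have hs0 : algebraMap _ K s ≠ 0 := div_ne_zero ha (pow_ne_zero r hy0)
  refine mem_reesValuationRings_iff.mpr ⟨hV.1, y * a, Ideal.mul_mem_mul hy haI,
    mul_ne_zero hy0' ha0, ?_, ?_, fun C hC hle => ?_⟩
  · exact blowupChart_le hA (div_mul_mem_of_mem_mul (C := V.toSubring)
      (fun p hp => hD (div_mem_blowupChart hp))
      fun b hb => (div_mem_iff_valuation_le ha).mpr (hmax b hb))
  · have hslt := valuation_lt_one_of_mem_reesValuationRings hV hsT
    have e : algebraMap R K (y * a) = algebraMap _ K s * algebraMap R K (y ^ (r + 1)) := by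
      change _ = algebraMap R K a / algebraMap R K y ^ r * _
      rw [map_mul, map_pow, pow_succ]
      field_simp
    rw [e, map_mul]
    exact mul_lt_one_of_lt_of_le hslt ((V.valuation_le_one_iff _).mpr (hA _))
  -- Cancelling a in pa/(ya) and y in yb/(ya) recovers both charts. Saturation then puts the local
  -- ring at Q, and hence the chart of the transform, inside C.
  · have hDC : blowupChart R K (maximalIdeal R) y ≤ C := by
      refine blowupChart_le (fun f => hle (algebraMap_mem_blowupChart f)) fun p hp => ?_
      have h := hle (div_mem_blowupChart (Ideal.mul_mem_mul hp haI))
      rwa [map_mul, map_mul, mul_div_mul_right _ _ ha] at h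
    refine eq_of_mem_reesValuationRings hV hsT hs0 hC (blowupChart_transform_le hy hy2 hQ hI hI' hN
      (hC.ofPrime_le hDC hSV) (fun b hb => ?_) rfl)
    have h := hle (div_mem_blowupChart (Ideal.mul_mem_mul hy hb))
    rwa [map_mul, map_mul, mul_div_mul_left _ _ hy0] at h

end BasePoints

/-! ### Rees valuation rings of 𝔪I other than the order valuation ring. -/

section Main

universe u v

variable {R : Type u} {K : Type v} [CommRing R] [IsDomain R] [IsRegularLocalRing R] [Field K]
  [Algebra R K] [IsFractionRing R K] {I : Ideal R} {r N : ℕ} {V W : ValuationSubring K}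

/-- A Rees valuation ring of the product of `I` with the maximal ideal other than the order
valuation ring is a Rees valuation ring of `I` and of the transform of `I` in a base point. -/
theorem IsOrderValuationRing.mem_reesValuationRings_of_mem_mul (hW : IsOrderValuationRing R K W)
    (hfin : (firstBasePoints K I).Finite) (hI : I ≤ maximalIdeal R ^ r)
    (hI' : ¬ I ≤ maximalIdeal R ^ (r + 1)) (hN : maximalIdeal R ^ N ≤ I)
    (hm : maximalIdeal R ≠ ⊥) (hV : V ∈ reesValuationRings R K (maximalIdeal R * I))
    (hVW : V ≠ W) :
    V ∈ reesValuationRings R K I ∧ ∃ S ∈ firstBasePoints K I,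
      V ∈ reesValuationRings S.toSubring K (transform I S.toSubring) := by
  have hdvr : IsDiscreteValuationRing V := hV.1
  have hinj := FaithfulSMul.algebraMap_injective R K
  have hA := algebraMap_mem_of_mem_reesValuationRings hV
  obtain ⟨y, hy, hy0', hymax⟩ := exists_forall_valuation_le hA hm
  obtain ⟨a, haI, ha0, hmax⟩ := exists_forall_valuation_le (J := I) hA
    fun h => hI' (h ▸ bot_le)
  have hy0 : algebraMap R K y ≠ 0 := fun h => hy0' (hinj (h.trans (map_zero _).symm))
  have ha : algebraMap R K a ≠ 0 := fun h => ha0 (hinj (h.trans (map_zero _).symm))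
  -- The power y^(N+1) lies in 𝔪I, whose elements have value less than 1.
  have hlt : V.valuation (algebraMap R K y) < 1 := by
    by_contra h
    have h1 := valuation_lt_one_of_mem_reesValuationRings hV
      (Ideal.mul_mem_mul hy (hN (Ideal.pow_mem_pow hy N)))
    rw [map_mul, map_mul, map_pow, map_pow, ← pow_succ'] at h1
    exact absurd (one_le_pow_of_one_le' (not_lt.mp h) (N + 1)) (not_le.mpr h1)
  have hD := blowupChart_le_valuationSubring hA hy0 hymax
  have hy2 := notMem_sq_of_blowupChart_le hy0 hD hlt
  have hIV := blowupChart_le_valuationSubring hA ha hmax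
  have hB : normalizedBlowupChart R K I a ≤ V.toSubring :=
    normalizedBlowupChart_le (fun z hz => mem_valuationSubring_of_isIntegral V hz) hIV
  have hmin : ∀ C, IsSaturatedIn V C → blowupChart R K (maximalIdeal R) y ≤ C →
      blowupChart R K I a ≤ C → C = V.toSubring := fun C hC h1 h2 =>
    eq_of_mem_reesValuationRings hV (Ideal.mul_mem_mul hy haI)
      (by rw [map_mul]; exact mul_ne_zero hy0 ha) hC
      (blowupChart_le (fun f => h1 (algebraMap_mem_blowupChart f))
        (div_mul_mem_of_mem_mul (fun _ hb => h1 (div_mem_blowupChart hb))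
          fun _ hb => h2 (div_mem_blowupChart hb)))
  set Q := center V _ hD with hQdef
  have hQ : chartHom R K (maximalIdeal R) y y ∈ Q := mem_center_iff.mpr hlt
  have hDS := LocalSubring.le_ofPrime (blowupChart R K (maximalIdeal R) y) Q
  have hSV : (LocalSubring.ofPrime _ Q).toSubring ≤ V.toSubring :=
    (isSaturatedIn_ofPrime_chart hy hy2 hD hlt).le
  let u : blowupChart R K (maximalIdeal R) y :=
    ⟨algebraMap R K a / algebraMap R K y ^ r, div_pow_mem_blowupChart (hI haI)⟩
  have hdiv : ∀ b, algebraMap R K b / algebraMap R K a =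
      algebraMap R K b / algebraMap R K y ^ r * (u : K)⁻¹ := fun b => by
    change _ = _ * (algebraMap R K a / algebraMap R K y ^ r)⁻¹
    field_simp
  -- Otherwise D_Q contains both charts, so minimality gives D_Q = V and hence V = W.
  have huQ : u ∈ Q := by
    by_contra huQ
    refine hVW (hW.eq_of_ofPrime_center_eq hy hy2 hD hlt (hmin _
      (isSaturatedIn_ofPrime_chart hy hy2 hD hlt) hDS
      (blowupChart_le (fun f => hDS (algebraMap_mem_blowupChart f)) fun b hb => ?_)))
    rw [hdiv]
    exact mul_mem (hDS (div_pow_mem_blowupChart (hI hb)))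
      (LocalSubring.mem_ofPrime_iff.mpr ⟨1, u, huQ, by simp⟩)
  have hbase : ∀ z : blowupChart R K (maximalIdeal R) y, (∃ b ∈ I,
      (z : K) = algebraMap R K b / algebraMap R K y ^ r) → z ∈ Q := by
    rintro z ⟨b, hb, hz⟩
    have e : (z : K) = algebraMap R K b / algebraMap R K a * u := by
      change _ = _ * (algebraMap R K a / algebraMap R K y ^ r)
      rw [hz]
      field_simp
    rw [hQdef, mem_center_iff, e, map_mul]
    exact (mul_le_of_le_one_left' ((V.valuation_le_one_iff _).mpr
      (hIV (div_mem_blowupChart hb)))).trans_lt (mem_center_iff.mp huQ)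
  have hultV : V.valuation (u : K) < 1 := mem_center_iff.mp huQ
  constructor
  · refine mem_reesValuationRings_iff.mpr ⟨hdvr, a, haI, ha0, hIV, ?_, fun C hC hle => ?_⟩
    · have e : algebraMap R K a = u * algebraMap R K (y ^ r) := by
        rw [map_pow]
        exact (div_mul_cancel₀ _ (pow_ne_zero r hy0)).symm
      rw [e, map_mul]
      exact mul_lt_one_of_lt_of_le hultV ((V.valuation_le_one_iff _).mpr (hA _))
    · obtain ⟨hdvrW, P, hP, hPy, hWP⟩ := hW.exists_eq_ofPrime hy hy2
      -- Any saturated ring above the chart of I contains A, hence D, so minimality for 𝔪I becomes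
      -- minimality for I.
      have hcore := blowupChart_le_ofPrime_center hVW ne_top_of_isDiscreteValuationRing hy hy2 hPy
        hWP hI haI ha hB hD hlt hmin fun Q' _ hQ' hbase' =>
          isIntegral_residue_of_finite_firstBasePoints hfin hy hy2 hI hI' hN Q' hQ' hbase'
      refine hmin C hC (hcore.trans (hC.ofPrime_le (normalizedBlowupChart_le hC.integral_mem hle)
        ?_)) hle
      exact (isSaturatedIn_ofPrime_center hB
        fun z hz => mem_normalizedBlowupChart_of_isIntegral hz).le
  · refine ⟨_, ofPrime_mem_firstBasePoints hy hy2 hQ hI hI' hN hbase, ?_⟩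
    let s : (LocalSubring.ofPrime _ Q).toSubring := ⟨u, hDS u.2⟩
    refine mem_reesValuationRings_iff.mpr ⟨hdvr, s,
      mem_transform_of_eq_div hy hy2 hQ hI hI' hN haI rfl, fun h => ?_,
      blowupChart_transform_le hy hy2 hQ hI hI' hN hSV
        (fun b hb => hIV (div_mem_blowupChart hb)) rfl, hultV, fun C hC hle => ?_⟩
    · exact div_ne_zero ha (pow_ne_zero r hy0) (congrArg Subtype.val h)
    · have hSC : (LocalSubring.ofPrime _ Q).toSubring ≤ C := fun z hz =>
        hle (algebraMap_mem_blowupChart (⟨z, hz⟩ : (LocalSubring.ofPrime _ Q).toSubring))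
      refine hmin C hC (hDS.trans hSC) (blowupChart_le
        (fun f => hSC (hDS (algebraMap_mem_blowupChart f))) fun b hb => ?_)
      have h := hle (div_mem_blowupChart (mem_transform_of_eq_div hy hy2 hQ hI hI' hN
        (s := ⟨_, hDS (div_pow_mem_blowupChart (hI hb))⟩) hb rfl))
      rw [hdiv, ← div_eq_mul_inv]
      exact h

end Main

end QuadTransform

/-! ### The main theorem. -/

theorem mainTheorem6 {R K : Type*} [CommRing R] [IsDomain R] [IsRegularLocalRing R] [Field K]
    [Algebra R K] [IsFractionRing R K] (hdim : 2 ≤ ringKrullDim R)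
    (I : Ideal R) (hprim : I.IsPrimary) (hrad : I.radical = IsLocalRing.maximalIdeal R)
    (hfin : (QuadTransform.firstBasePoints K I).Finite) :
    ∃ ordR : ValuationSubring K, QuadTransform.IsOrderValuationRing R K ordR ∧
      {ordR} ∪ QuadTransform.reesValuationRings R K I =
        {ordR} ∪ ⋃ S ∈ QuadTransform.firstBasePoints K I,
          QuadTransform.reesValuationRings S.toSubring K
            (QuadTransform.transform I S.toSubring) ∧
      QuadTransform.reesValuationRings R K (IsLocalRing.maximalIdeal R * I) =
        QuadTransform.reesValuationRings R K (IsLocalRing.maximalIdeal R) ∪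
          QuadTransform.reesValuationRings R K I ∧
      QuadTransform.reesValuationRings R K (IsLocalRing.maximalIdeal R) ∪
          QuadTransform.reesValuationRings R K I =
        {ordR} ∪ QuadTransform.reesValuationRings R K I := by
  obtain ⟨N, hN⟩ : ∃ N, maximalIdeal R ^ N ≤ I := hrad ▸ I.exists_radical_pow_le_of_fg
    (IsNoetherian.noetherian _)
  have hm : maximalIdeal R ≠ ⊥ := by
    intro h
    rw [ringKrullDim_eq_zero_of_isField (isField_iff_maximalIdeal_eq.mpr h)] at hdim
    exact absurd hdim (by decide)
  have hI0 : I ≠ ⊥ := by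
    rintro rfl
    exact hm (hrad.symm.trans Ideal.isPrime_bot.radical)
  obtain ⟨y, hy, hy2⟩ : ∃ y ∈ maximalIdeal R, y ∉ maximalIdeal R ^ 2 := by
    by_contra! h
    obtain ⟨x, hx, hx0⟩ := Submodule.exists_mem_ne_zero_of_ne_bot hm
    obtain ⟨n, -, hn⟩ := QuadTransform.exists_mem_pow_notMem_pow_succ hx0
    refine hn ?_
    -- If 𝔪 = 𝔪², all powers of 𝔪 agree, so no nonzero element of 𝔪 has finite order.
    have hle : ∀ k, maximalIdeal R ≤ maximalIdeal R ^ (k + 1) := by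
      intro k
      induction k with
      | zero => simp
      | succ k ih =>
        calc maximalIdeal R ≤ maximalIdeal R ^ 2 := h
          _ = maximalIdeal R * maximalIdeal R := pow_two _
          _ ≤ maximalIdeal R ^ (k + 1) * maximalIdeal R := Ideal.mul_mono_left ih
          _ = maximalIdeal R ^ (k + 1 + 1) := (pow_succ _ _).symm
    exact hle n hx
  obtain ⟨r, hI, hI'⟩ : ∃ r, I ≤ maximalIdeal R ^ r ∧ ¬ I ≤ maximalIdeal R ^ (r + 1) := by
    by_contra! h
    obtain ⟨b, hb, hb0⟩ := Submodule.exists_mem_ne_zero_of_ne_bot hI0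
    obtain ⟨n, -, hn⟩ := QuadTransform.exists_mem_pow_notMem_pow_succ hb0
    have hle : ∀ k, I ≤ maximalIdeal R ^ k := by
      intro k
      induction k with
      | zero => simp
      | succ k ih => exact h k ih
    exact hn (hle _ hb)
  obtain ⟨W, hW, -⟩ := QuadTransform.exists_isOrderValuationRing (K := K) hy hy2
  have hWm := hW.reesValuationRings_maximalIdeal hy hy2
  have hmI : QuadTransform.reesValuationRings R K (maximalIdeal R * I) =
      {W} ∪ QuadTransform.reesValuationRings R K I := by
    refine Set.Subset.antisymm (fun V hV => ?_) (Set.union_subset ?_ ?_)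
    · by_cases hVW : V = W
      · exact .inl hVW
      · exact .inr (hW.mem_reesValuationRings_of_mem_mul hfin hI hI' hN hm hV hVW).1
    · rw [← hWm]
      exact QuadTransform.reesValuationRings_subset_mul _ hI0
    · rw [mul_comm]
      exact QuadTransform.reesValuationRings_subset_mul _ hm
  refine ⟨W, hW, ?_, by rw [hWm, hmI], by rw [hWm]⟩
  -- Both sides are now compared with Rees(𝔪I).
  rw [← hmI]
  refine Set.Subset.antisymm (fun V hV => ?_) (Set.union_subset ?_ fun V hV => ?_)
  · by_cases hVW : V = W
    · exact .inl hVW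
    · obtain ⟨S, hS, hVS⟩ := (hW.mem_reesValuationRings_of_mem_mul hfin hI hI' hN hm hV hVW).2
      exact .inr (Set.mem_biUnion hS hVS)
  · rw [hmI]
    exact Set.subset_union_left
  · obtain ⟨S, hS, hVS⟩ := Set.mem_iUnion₂.mp hV
    exact QuadTransform.mem_reesValuationRings_mul_of_mem_firstBasePoints hI hI' hN hS hVS
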